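/- Let $\mathbb{F}$ be the field of real or complex scalars, let $0<p<\infty$, and let $w=(w_j)_{j=1}^\infty$ be a weight with $w\in c_0\setminus\ell_1$ and $1=w_1\ge w_2\ge\cdots>0$. Let $$d(w,p)=\Big\{a=(a_j)_{j=1}^\infty\in c_0 : \|a\|_{d(w,p)}:=\Big(\sum_{j=1}^\infty (a_j^*)^p\, w_j\Big)^{1/p}<\infty\Big\}$$ be the weighted Lorentz sequence space over $\mathbb{F}$, where $(a_j^*)_{j=1}^\infty$ is the decreasing rearrangement of $(|a_j|)_{j=1}^\infty$; convergence and closures in $d(w,p)$ are taken with respect to the quasi-norm $\|\cdot\|_{d(w,p)}$. A sequence $(x_j)_{j=1}^\infty$ in $d(w,p)$ is a basic sequence if every $v$ in its closed linear span has a unique expansion $v=\sum_{j=1}^\infty a_j x_j$ with scalars $a_j$. Two basic sequences $(x_j)$ and $(y_j)$ are equivalent if, for all scalar sequences $(a_j)$, the series $\sum_j a_jx_j$ converges if and only if $\sum_j a_j y_j$ converges. A basic sequence $(x_j)$ is unconditional if $(x_{\pi(j)})$ is a basic sequence for every permutation $\pi$ of $\mathbb{N}$; it is subsymmetric if it is unconditional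 and $(x_{\phi(j)})$ is equivalent to $(x_j)$ for every strictly increasing $\phi:\mathbb{N}\to\mathbb{N}$; and it is symmetric if $(x_{\pi(j)})$ is a basic sequence equivalent to $(x_j)$ for every permutation $\pi$ of $\mathbb{N}$. Theorem. Every subsymmetric basic sequence of $d(w,p)$ is symmetric. -/

import Mathlib

open Filter Topology
open scoped ENNReal

/-! ### Quasi-norms and basic sequences -/

/-- A quasi-norm on a vector space over `𝕜`. -/
structure VecQuasiNorm (𝕜 X : Type*) [RCLike 𝕜] [AddCommGroup X] [Module 𝕜 X] where
  toFun : X → ℝ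
  nonneg : ∀ v, 0 ≤ toFun v
  eq_zero_iff : ∀ v, toFun v = 0 ↔ v = 0
  smul_eq : ∀ (c : 𝕜) (v : X), toFun (c • v) = ‖c‖ * toFun v
  add_le : ∃ K : ℝ, ∀ u v, toFun (u + v) ≤ K * (toFun u + toFun v)

section BasicSequences

variable {𝕜 X : Type*} [RCLike 𝕜] [AddCommGroup X] [Module 𝕜 X]

/-- `v = ∑ j, a j • x j`, the limit of the ordered partial sums in the quasi-norm `q`. -/
def SeriesHasLimit (q : VecQuasiNorm 𝕜 X) (x : ℕ → X) (a : ℕ → 𝕜) (v : X) : Prop :=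
  Tendsto (fun n => q.toFun (v - ∑ j ∈ Finset.range n, a j • x j)) atTop (𝓝 0)

/-- The series `∑ j, a j • x j` converges in `X`. -/
def SeriesConverges (q : VecQuasiNorm 𝕜 X) (x : ℕ → X) (a : ℕ → 𝕜) : Prop :=
  ∃ v, SeriesHasLimit q x a v

/-- The closed linear span `[x j : j ∈ ℕ]`, closure being taken in the quasi-norm `q`. -/
def closedLinearSpan (q : VecQuasiNorm 𝕜 X) (x : ℕ → X) : Set X :=
  {v | ∀ ε : ℝ, 0 < ε → ∃ u ∈ Submodule.span 𝕜 (Set.range x), q.toFun (v - u) < ε}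

/-- `x` is a basic sequence: it is a (Schauder) basis of its closed linear span. -/
def IsBasicSeq (q : VecQuasiNorm 𝕜 X) (x : ℕ → X) : Prop :=
  ∀ v ∈ closedLinearSpan q x, ∃! a : ℕ → 𝕜, SeriesHasLimit q x a v

/-- `x` and `y` are equivalent basic sequences: `∑ j, a j • x j` converges if and only if
`∑ j, a j • y j` does. -/
def AreEquivalentBasicSeq (q : VecQuasiNorm 𝕜 X) (x y : ℕ → X) : Prop :=
  IsBasicSeq q x ∧ IsBasicSeq q y ∧
    ∀ a : ℕ → 𝕜, SeriesConverges q x a ↔ SeriesConverges q y a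

/-- `x` is an unconditional basic sequence: every rearrangement of it is a basic sequence. -/
def IsUnconditionalBasicSeq (q : VecQuasiNorm 𝕜 X) (x : ℕ → X) : Prop :=
  ∀ π : Equiv.Perm ℕ, IsBasicSeq q (fun j => x (π j))

/-- `x` is a subsymmetric basic sequence: unconditional, and equivalent to all its
subsequences. -/
def IsSubsymmetricBasicSeq (q : VecQuasiNorm 𝕜 X) (x : ℕ → X) : Prop :=
  IsBasicSeq q x ∧ IsUnconditionalBasicSeq q x ∧
    ∀ φ : ℕ → ℕ, StrictMono φ → AreEquivalentBasicSeq q (fun j => x (φ j)) x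

/-- `x` is a symmetric basic sequence: equivalent to all its rearrangements. -/
def IsSymmetricBasicSeq (q : VecQuasiNorm 𝕜 X) (x : ℕ → X) : Prop :=
  IsBasicSeq q x ∧
    ∀ π : Equiv.Perm ℕ, AreEquivalentBasicSeq q (fun j => x (π j)) x

end BasicSequences

/-! ### Weighted Lorentz sequence spaces -/

/-- The class `𝒲` of weights in `c₀ ∖ ℓ₁` with `1 = w₁ ≥ w₂ ≥ ⋯ > 0` (indices start at `0`). -/
def lorentzWeights : Set (ℕ → ℝ) :=
  {w | w 0 = 1 ∧ Antitone w ∧ (∀ j, 0 < w j) ∧ Tendsto w atTop (𝓝 0) ∧ ¬ Summable w}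

section Lorentz

variable {𝕜 : Type*} [RCLike 𝕜]

/-- The decreasing rearrangement of `(|a j|)`, with indices starting at `0`:
its `n`-th term is the least `t` such that at most `n` indices `j` satisfy `|a j| > t`. -/
noncomputable def decRearr (a : ℕ → 𝕜) (n : ℕ) : ℝ≥0∞ :=
  sInf {t : ℝ≥0∞ | {j : ℕ | t < ‖a j‖ₑ}.encard ≤ (n : ℕ∞)}

/-- `∑ j, (a* j) ^ p * w j`, possibly infinite. -/
noncomputable def lorentzSum (w : ℕ → ℝ) (p : ℝ) (a : ℕ → 𝕜) : ℝ≥0∞ :=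
  ∑' j, ENNReal.ofReal (w j) * decRearr a j ^ p

/-- `(∑ j, (a* j) ^ p * w j) ^ (1 / p)`, possibly infinite. -/
noncomputable def lorentzENorm (w : ℕ → ℝ) (p : ℝ) (a : ℕ → 𝕜) : ℝ≥0∞ :=
  lorentzSum w p a ^ (1 / p)

theorem decRearr_antitone (a : ℕ → 𝕜) : Antitone (decRearr a) := by
  intro m n h
  refine sInf_le_sInf fun t ht => ?_
  exact le_trans (Set.mem_ofPred.1 ht) (by exact_mod_cast h)

theorem decRearr_add_le (a b : ℕ → 𝕜) (m n : ℕ) :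
    decRearr (a + b) (m + n) ≤ decRearr a m + decRearr b n := by
  unfold decRearr
  rw [sInf_eq_iInf' {t : ℝ≥0∞ | {j : ℕ | t < ‖a j‖ₑ}.encard ≤ (m : ℕ∞)},
    sInf_eq_iInf' {t : ℝ≥0∞ | {j : ℕ | t < ‖b j‖ₑ}.encard ≤ (n : ℕ∞)}, ENNReal.iInf_add]
  refine le_iInf fun s => ?_
  rw [ENNReal.add_iInf]
  refine le_iInf fun t => sInf_le ?_
  have hsub : {j : ℕ | (s : ℝ≥0∞) + t < ‖(a + b) j‖ₑ} ⊆
      {j : ℕ | (s : ℝ≥0∞) < ‖a j‖ₑ} ∪ {j : ℕ | (t : ℝ≥0∞) < ‖b j‖ₑ} := by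
    intro j hj
    by_contra hcon
    simp only [Set.mem_union, Set.mem_ofPred_eq, not_or, not_lt] at hcon
    have h1 : ‖(a + b) j‖ₑ ≤ s + t :=
      (enorm_add_le (a j) (b j)).trans (add_le_add hcon.1 hcon.2)
    exact absurd (Set.mem_ofPred.1 hj) (not_lt.2 h1)
  have h2 := (Set.encard_le_encard hsub).trans (Set.encard_union_le _ _)
  refine Set.mem_ofPred.2 (h2.trans ?_)
  push_cast
  exact add_le_add s.2 t.2

theorem decRearr_smul_le (c : 𝕜) (hc : c ≠ 0) (a : ℕ → 𝕜) (n : ℕ) :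
    decRearr (c • a) n ≤ ‖c‖ₑ * decRearr a n := by
  have h0 : ‖c‖ₑ ≠ 0 := by simpa using hc
  have ht : ‖c‖ₑ ≠ ∞ := enorm_ne_top
  rw [mul_comm, ← ENNReal.div_le_iff_le_mul (Or.inl h0) (Or.inl ht)]
  refine le_sInf fun t h => ?_
  rw [ENNReal.div_le_iff_le_mul (Or.inl h0) (Or.inl ht)]
  refine sInf_le (le_trans (Set.encard_le_encard fun j hj => ?_) (Set.mem_ofPred.1 h))
  have hj' : t * ‖c‖ₑ < ‖(c • a) j‖ₑ := hj
  rw [Pi.smul_apply, enorm_smul, mul_comm t] at hj'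
  exact lt_of_mul_lt_mul_left' hj'

theorem decRearr_smul (c : 𝕜) (hc : c ≠ 0) (a : ℕ → 𝕜) (n : ℕ) :
    decRearr (c • a) n = ‖c‖ₑ * decRearr a n := by
  refine le_antisymm (decRearr_smul_le c hc a n) ?_
  have h := decRearr_smul_le c⁻¹ (inv_ne_zero hc) (c • a) n
  rw [inv_smul_smul₀ hc] at h
  calc ‖c‖ₑ * decRearr a n ≤ ‖c‖ₑ * (‖c⁻¹‖ₑ * decRearr (c • a) n) := by gcongr
    _ = decRearr (c • a) n := by
      rw [← mul_assoc, ← enorm_mul, mul_inv_cancel₀ hc, enorm_one, one_mul]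

theorem le_decRearr_zero (a : ℕ → 𝕜) (j : ℕ) : ‖a j‖ₑ ≤ decRearr a 0 := by
  refine le_sInf fun t ht => ?_
  have h : {j : ℕ | t < ‖a j‖ₑ} = ∅ := by simpa using ht
  by_contra hcon
  have : j ∈ {j : ℕ | t < ‖a j‖ₑ} := not_le.1 hcon
  simp [h] at this

theorem decRearr_zero (n : ℕ) : decRearr (0 : ℕ → 𝕜) n = 0 := by
  refine le_antisymm (sInf_le ?_) bot_le
  simp

theorem lorentzENorm_zero (w : ℕ → ℝ) {p : ℝ} (hp : 0 < p) :
    lorentzENorm w p (0 : ℕ → 𝕜) = 0 := by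
  simp [lorentzENorm, lorentzSum, decRearr_zero, hp]

theorem lorentzENorm_smul (w : ℕ → ℝ) {p : ℝ} (hp : 0 < p) (c : 𝕜) (a : ℕ → 𝕜) :
    lorentzENorm w p (c • a) = ‖c‖ₑ * lorentzENorm w p a := by
  by_cases hc : c = 0
  · subst hc
    rw [zero_smul, lorentzENorm_zero w hp]
    simp
  have h1 : lorentzSum w p (c • a) = ‖c‖ₑ ^ p * lorentzSum w p a := by
    unfold lorentzSum
    rw [← ENNReal.tsum_mul_left]
    refine tsum_congr fun j => ?_
    rw [decRearr_smul c hc, ENNReal.mul_rpow_of_nonneg _ _ hp.le]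
    ring
  unfold lorentzENorm
  rw [h1, ENNReal.mul_rpow_of_nonneg _ _ (by positivity), ← ENNReal.rpow_mul,
    mul_one_div_cancel hp.ne', ENNReal.rpow_one]

theorem ennreal_add_rpow_le {p : ℝ} (hp : 0 < p) (s t : ℝ≥0∞) :
    (s + t) ^ p ≤ 2 ^ p * (s ^ p + t ^ p) := by
  have h : s + t ≤ 2 * max s t := by
    rw [two_mul]; exact add_le_add (le_max_left _ _) (le_max_right _ _)
  refine (ENNReal.rpow_le_rpow h hp.le).trans ?_
  rw [ENNReal.mul_rpow_of_nonneg _ _ hp.le]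
  gcongr
  rcases max_choice s t with h | h <;> rw [h]
  · exact le_self_add
  · exact le_add_self

theorem lorentzSum_add_le {w : ℕ → ℝ} (hw : Antitone w) {p : ℝ} (hp : 0 < p) (a b : ℕ → 𝕜) :
    lorentzSum w p (a + b) ≤ 2 * 2 ^ p * (lorentzSum w p a + lorentzSum w p b) := by
  have key : ∀ k i : ℕ, ENNReal.ofReal (w (2 * k + i)) * decRearr (a + b) (2 * k + i) ^ p ≤
      2 ^ p * (ENNReal.ofReal (w k) * decRearr a k ^ p + ENNReal.ofReal (w k) * decRearr b k ^ p) := by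
    intro k i
    have h1 : decRearr (a + b) (2 * k + i) ≤ decRearr a k + decRearr b k :=
      (decRearr_antitone (a + b) (by lia : k + k ≤ 2 * k + i)).trans (decRearr_add_le a b k k)
    have h2 : w (2 * k + i) ≤ w k := hw (by lia)
    calc _ ≤ ENNReal.ofReal (w k) * (2 ^ p * (decRearr a k ^ p + decRearr b k ^ p)) :=
          mul_le_mul' (ENNReal.ofReal_le_ofReal h2)
            ((ENNReal.rpow_le_rpow h1 hp.le).trans (ennreal_add_rpow_le hp _ _))
      _ = _ := by ring
  have hs : ∀ i : ℕ,
      ∑' k, ENNReal.ofReal (w (2 * k + i)) * decRearr (a + b) (2 * k + i) ^ p ≤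
        2 ^ p * (lorentzSum w p a + lorentzSum w p b) := by
    intro i
    refine (ENNReal.tsum_le_tsum fun k => key k i).trans ?_
    rw [ENNReal.tsum_mul_left, ENNReal.tsum_add]
    rfl
  have h3 := tsum_even_add_odd
    (f := fun j => ENNReal.ofReal (w j) * decRearr (a + b) j ^ p)
    ENNReal.summable ENNReal.summable
  have h4 : lorentzSum w p (a + b) =
      ∑' j, ENNReal.ofReal (w j) * decRearr (a + b) j ^ p := rfl
  rw [h4, ← h3, mul_assoc, two_mul]
  exact add_le_add (hs 0) (hs 1)

theorem lorentzENorm_add_le {w : ℕ → ℝ} (hw : Antitone w) {p : ℝ} (hp : 0 < p) (a b : ℕ → 𝕜) :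
    lorentzENorm w p (a + b) ≤
      ((2 * 2 ^ p) ^ (1 / p) * 2 ^ (1 / p)) * (lorentzENorm w p a + lorentzENorm w p b) := by
  have hp' : 0 < 1 / p := by positivity
  unfold lorentzENorm
  refine (ENNReal.rpow_le_rpow (lorentzSum_add_le hw hp a b) hp'.le).trans ?_
  rw [ENNReal.mul_rpow_of_nonneg _ _ hp'.le, mul_assoc]
  gcongr
  exact ennreal_add_rpow_le hp' _ _

theorem lorentzConst_ne_top {p : ℝ} (hp : 0 < p) :
    ((2 : ℝ≥0∞) * 2 ^ p) ^ (1 / p) * 2 ^ (1 / p) ≠ ∞ := by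
  have hp' : 0 ≤ 1 / p := by positivity
  refine ENNReal.mul_ne_top (ENNReal.rpow_ne_top_of_nonneg hp' (ENNReal.mul_ne_top (by simp) ?_))
    (ENNReal.rpow_ne_top_of_nonneg hp' (by simp))
  exact ENNReal.rpow_ne_top_of_nonneg hp.le (by simp)

variable (𝕜) in
/-- The weighted Lorentz sequence space `d(w, p)`: all `a ∈ c₀` with
`(∑ j, (a* j) ^ p * w j) ^ (1 / p) < ∞`. -/
noncomputable def lorentzSpace (w : ℕ → ℝ) (hw : w ∈ lorentzWeights) (p : ℝ) (hp : 0 < p) :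
    Submodule 𝕜 (ℕ → 𝕜) where
  carrier := {a | Tendsto a atTop (𝓝 0) ∧ lorentzENorm w p a < ∞}
  zero_mem' := ⟨tendsto_const_nhds, by simp [lorentzENorm_zero w hp]⟩
  add_mem' := by
    rintro a b ⟨ha, ha'⟩ ⟨hb, hb'⟩
    refine ⟨by have h := ha.add hb; rw [add_zero] at h; exact h, (lorentzENorm_add_le hw.2.1 hp a b).trans_lt ?_⟩
    exact ENNReal.mul_lt_top (lorentzConst_ne_top hp).lt_top (ENNReal.add_lt_top.2 ⟨ha', hb'⟩)
  smul_mem' := by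
    rintro c a ⟨ha, ha'⟩
    refine ⟨by have h := ha.const_smul c; rw [smul_zero] at h; exact h, ?_⟩
    rw [lorentzENorm_smul w hp]
    exact ENNReal.mul_lt_top enorm_lt_top ha'

variable (𝕜) in
/-- The quasi-norm `(∑ j, (a* j) ^ p * w j) ^ (1 / p)` of `d(w, p)`. -/
noncomputable def lorentzQuasiNorm (w : ℕ → ℝ) (hw : w ∈ lorentzWeights) (p : ℝ) (hp : 0 < p) :
    VecQuasiNorm 𝕜 (lorentzSpace 𝕜 w hw p hp) where
  toFun a := (lorentzENorm w p (a : ℕ → 𝕜)).toReal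
  nonneg _ := ENNReal.toReal_nonneg
  eq_zero_iff := by
    rintro ⟨a, ha, ha'⟩
    rw [ENNReal.toReal_eq_zero_iff]
    constructor
    · rintro (h | h)
      · have hp' : 0 < 1 / p := by positivity
        have h1 : lorentzSum w p a = 0 := (ENNReal.rpow_eq_zero_iff_of_pos hp').1 h
        have h2 := ENNReal.tsum_eq_zero.1 h1 0
        rw [hw.1, ENNReal.ofReal_one, one_mul, ENNReal.rpow_eq_zero_iff_of_pos hp] at h2
        refine Subtype.ext (funext fun j => ?_)
        have h3 := le_decRearr_zero a j
        rw [h2] at h3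
        simpa using h3
      · exact absurd h ha'.ne
    · intro h
      left
      have h1 : a = 0 := congrArg Subtype.val h
      subst h1
      exact lorentzENorm_zero w hp
  smul_eq := by
    rintro c ⟨a, ha⟩
    have h := lorentzENorm_smul w hp c a
    simp only [Submodule.coe_smul, h, ENNReal.toReal_mul, toReal_enorm]
  add_le := by
    refine ⟨((((2 : ℝ≥0∞) * 2 ^ p) ^ (1 / p) * 2 ^ (1 / p)) : ℝ≥0∞).toReal, ?_⟩
    rintro ⟨a, ha, ha'⟩ ⟨b, hb, hb'⟩
    have h := lorentzENorm_add_le hw.2.1 hp a b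
    have hs : lorentzENorm w p a + lorentzENorm w p b ≠ ∞ :=
      ENNReal.add_ne_top.2 ⟨ha'.ne, hb'.ne⟩
    have h2 := ENNReal.toReal_mono (ENNReal.mul_ne_top (lorentzConst_ne_top hp) hs) h
    rwa [ENNReal.toReal_mul, ENNReal.toReal_add ha'.ne hb'.ne] at h2

end Lorentz

/-! A subsymmetric sequence has the same convergent series as each of its subsequences, so it is
enough to find one subsequence along which convergence of `∑ a j • x j` survives every permutation
of the coefficients. Unconditionality permutes vectors and coefficients together, so this gives
symmetry (`isSymmetricBasicSeq_of_subseq`).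

Subsymmetry forces `x` to be bounded above and bounded away from zero in quasi-norm. A diagonal
argument gives a subsequence converging coordinatewise to some `y` in the space, and a gliding hump
replaces `x j - y` by disjointly and finitely supported `u j` up to a summable error. If `y ≠ 0`, a
coordinate functional that does not vanish at `y` shows, by unconditionality, that convergence
forces `a ∈ ℓ₁`, and then `∑ a j • y` converges in any order. So only the disjoint vectors `u j`
matter.

For disjoint vectors, convergence means finiteness of the Lorentz sum of the disjoint union of the
sequences `|a j|^p |u j|^p` (`seriesConverges_iff_of_disjoint`), and each may be sorted
decreasingly. Along a subsequence the sorted sequences converge pointwise to some `v`. Cut the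
`j`-th one at a place `n j` such that the head agrees with `v`, and `v` is negligible beyond `n j`,
up to summable errors. The copies of `v` contribute a quantity that clearly does not see the order
of the coefficients. The tails are flat: their largest terms tend to `0`. Either a subsequence of
tails has summable size and contributes nothing, or the sizes stay bounded below. In the second case
flat sequences can be placed on successive disjoint windows of the weight, a further subsequence
satisfies a lower `ℓ₁`-estimate in `|a j|^p`, and finiteness just means `∑ |a j|^p < ∞`
(`exists_subseq_tsum_le_wsup`). All contributions are permutation invariant
(`exists_subseq_wsup_symmetric`).

The Lorentz sum is handled throughout as `wsup`, a supremum over injective assignments of weights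
(`lorentzSum_eq_wsup`). It makes sense over any index type, so a disjoint union is simply a family
on `ℕ × ℕ`, and it is visibly subadditive and lower semicontinuous. -/

/-! ### The rearrangement-invariant weighted supremum -/

/-- The supremum of the sums `∑ i ∈ A, W (τ i) * h i` over finite sets `A` and maps `τ` that are
injective on `A`. -/
noncomputable def wsup (W : ℕ → ℝ≥0∞) {ι : Type*} (h : ι → ℝ≥0∞) : ℝ≥0∞ :=
  ⨆ (A : Finset ι) (τ : ι → ℕ) (_ : Set.InjOn τ (A : Set ι)), ∑ i ∈ A, W (τ i) * h i

section wsup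

variable {W : ℕ → ℝ≥0∞} {ι κ : Type*}

theorem sum_le_wsup (W : ℕ → ℝ≥0∞) (h : ι → ℝ≥0∞) (A : Finset ι) (τ : ι → ℕ)
    (hτ : Set.InjOn τ (A : Set ι)) : ∑ i ∈ A, W (τ i) * h i ≤ wsup W h :=
  le_iSup_of_le A (le_iSup_of_le τ (le_iSup_of_le hτ le_rfl))

theorem wsup_le {h : ι → ℝ≥0∞} {B : ℝ≥0∞}
    (H : ∀ (A : Finset ι) (τ : ι → ℕ), Set.InjOn τ (A : Set ι) → ∑ i ∈ A, W (τ i) * h i ≤ B) :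
    wsup W h ≤ B :=
  iSup_le fun A => iSup_le fun τ => iSup_le fun hτ => H A τ hτ

theorem wsup_mono {g h : ι → ℝ≥0∞} (H : ∀ i, g i ≤ h i) : wsup W g ≤ wsup W h :=
  wsup_le fun A τ hτ =>
    (Finset.sum_le_sum fun i _ => mul_le_mul_right (H i) (W (τ i))).trans (sum_le_wsup W h A τ hτ)

theorem wsup_add_le (g h : ι → ℝ≥0∞) : wsup W (fun i => g i + h i) ≤ wsup W g + wsup W h := by
  refine wsup_le fun A τ hτ => ?_
  simp only [mul_add, Finset.sum_add_distrib]
  exact add_le_add (sum_le_wsup W g A τ hτ) (sum_le_wsup W h A τ hτ)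

theorem wsup_const_mul_le (c : ℝ≥0∞) (h : ι → ℝ≥0∞) :
    wsup W (fun i => c * h i) ≤ c * wsup W h := by
  refine wsup_le fun A τ hτ => ?_
  simp only [mul_left_comm _ c, ← Finset.mul_sum]
  exact mul_le_mul_right (sum_le_wsup W h A τ hτ) c

theorem mul_le_wsup (W : ℕ → ℝ≥0∞) (h : ι → ℝ≥0∞) (i : ι) : W 0 * h i ≤ wsup W h := by
  simpa using sum_le_wsup W h {i} (fun _ => 0) (by simp)

/-- An assignment of weights is transported along the inverse of `e`. Injectivity is needed only on
the support of `g`, which lets one lemma serve for shifts, for dropping zeros and for collapsing `ℕ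
× ℕ` onto `ℕ` when supports are disjoint. -/
theorem wsup_le_wsup_of_injOn (e : ι → κ) {g : ι → ℝ≥0∞} {h : κ → ℝ≥0∞}
    (he : Set.InjOn e {i | g i ≠ 0}) (H : ∀ i, g i ≠ 0 → g i ≤ h (e i)) :
    wsup W g ≤ wsup W h := by
  classical
  refine wsup_le fun A τ hτ => ?_
  rcases isEmpty_or_nonempty ι with hι | hι
  · simp [Finset.eq_empty_of_isEmpty A]
  set A' := A.filter fun i => g i ≠ 0
  have hA' : Set.InjOn e (A' : Set ι) := he.mono fun i hi => by simp [A'] at hi; exact hi.2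
  have h1 : ∑ i ∈ A, W (τ i) * g i = ∑ i ∈ A', W (τ i) * g i := by
    rw [Finset.sum_filter]
    refine Finset.sum_congr rfl fun i _ => ?_
    by_cases hi : g i = 0 <;> simp [hi]
  have hinv : ∀ i ∈ A', Function.invFunOn e (A' : Set ι) (e i) = i := fun i hi =>
    hA'.leftInvOn_invFunOn hi
  rw [h1]
  calc ∑ i ∈ A', W (τ i) * g i
      ≤ ∑ i ∈ A', W (τ (Function.invFunOn e (A' : Set ι) (e i))) * h (e i) := by
        refine Finset.sum_le_sum fun i hi => ?_
        rw [hinv i hi]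
        exact mul_le_mul_right (H i (Finset.mem_filter.1 hi).2) _
    _ = ∑ k ∈ A'.image e, W (τ (Function.invFunOn e (A' : Set ι) k)) * h k :=
        (Finset.sum_image (f := fun k => W (τ (Function.invFunOn e (A' : Set ι) k)) * h k) hA').symm
    _ ≤ wsup W h := by
        refine sum_le_wsup W h _ (fun k => τ (Function.invFunOn e (A' : Set ι) k)) ?_
        rintro k hk l hl hkl
        simp only [Finset.coe_image, Set.mem_image, Finset.mem_coe] at hk hl
        obtain ⟨i, hi, rfl⟩ := hk
        obtain ⟨j, hj, rfl⟩ := hl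
        simp only [hinv i hi, hinv j hj] at hkl
        rw [hτ (Finset.mem_filter.1 hi).1 (Finset.mem_filter.1 hj).1 hkl]

theorem wsup_comp_equiv (e : ι ≃ κ) (h : κ → ℝ≥0∞) : wsup W (fun i => h (e i)) = wsup W h := by
  refine le_antisymm (wsup_le_wsup_of_injOn e e.injective.injOn fun _ _ => le_rfl)
    (wsup_le_wsup_of_injOn e.symm e.symm.injective.injOn fun k _ => ?_)
  simp

/-- The trivial upper `ℓ₁`-estimate: an injective assignment on the product restricts to an
injective assignment on each fibre. -/
theorem wsup_prod_le (c : ι → ℝ≥0∞) (D : ι → κ → ℝ≥0∞) :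
    wsup W (fun x : ι × κ => c x.1 * D x.1 x.2) ≤ ∑' j, c j * wsup W (D j) := by
  classical
  refine wsup_le fun A τ hτ => ?_
  rw [← Finset.sum_fiberwise_of_maps_to (t := A.image Prod.fst) (g := Prod.fst)
    fun x hx => Finset.mem_image_of_mem _ hx]
  refine (Finset.sum_le_sum fun j _ => ?_).trans (ENNReal.sum_le_tsum (A.image Prod.fst))
  calc ∑ x ∈ A with x.1 = j, W (τ x) * (c x.1 * D x.1 x.2)
      = ∑ x ∈ A with x.1 = j, W (τ x) * (if x.1 = j then c j * D j x.2 else 0) := by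
        refine Finset.sum_congr rfl fun x hx => ?_
        have hx' := (Finset.mem_filter.1 hx).2
        subst hx'
        simp
    _ ≤ wsup W (fun x : ι × κ => if x.1 = j then c j * D j x.2 else 0) :=
        sum_le_wsup W _ _ τ (hτ.mono fun x hx => (Finset.mem_filter.1 hx).1)
    _ ≤ wsup W (fun k => c j * D j k) := by
        refine wsup_le_wsup_of_injOn Prod.snd ?_ ?_
        · rintro ⟨i, k⟩ hx ⟨i', k'⟩ hy (h : k = k')
          have h1 : i = j := by by_contra h; exact hx (by simp [h])
          have h2 : i' = j := by by_contra h; exact hy (by simp [h])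
          rw [h1, h2, h]
        · rintro ⟨i, k⟩ hx
          have h1 : i = j := by by_contra h; exact hx (by simp [h])
          simp [h1]
    _ ≤ c j * wsup W (D j) := wsup_const_mul_le _ _

theorem wsup_le_finset_sum (hW : ∀ k, W k ≤ 1) (h : ι → ℝ≥0∞) (S : Finset ι)
    (hS : ∀ i ∉ S, h i = 0) : wsup W h ≤ ∑ i ∈ S, h i := by
  classical
  refine wsup_le fun A τ _ => ?_
  calc ∑ i ∈ A, W (τ i) * h i ≤ ∑ i ∈ A, h i :=
        Finset.sum_le_sum fun i _ => (mul_le_mul_left (hW _) _).trans (one_mul _).le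
    _ ≤ ∑ i ∈ A ∪ S, h i := Finset.sum_le_sum_of_subset Finset.subset_union_left
    _ = ∑ i ∈ S, h i :=
        (Finset.sum_subset Finset.subset_union_right fun i _ hi => hS i hi).symm

theorem wsup_le_of_tendsto (hW : ∀ k, W k ≠ ∞) {g : ℕ → ι → ℝ≥0∞} {h : ι → ℝ≥0∞} {B : ℝ≥0∞}
    (hg : ∀ i, Tendsto (fun n => g n i) atTop (𝓝 (h i))) (hB : ∀ᶠ n in atTop, wsup W (g n) ≤ B) :
    wsup W h ≤ B := by
  refine wsup_le fun A τ hτ => ?_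
  have h1 : Tendsto (fun n => ∑ i ∈ A, W (τ i) * g n i) atTop (𝓝 (∑ i ∈ A, W (τ i) * h i)) :=
    tendsto_finsetSum _ fun i _ => ENNReal.Tendsto.const_mul (hg i) (Or.inr (hW _))
  exact le_of_tendsto h1 (hB.mono fun n hn => (sum_le_wsup W (g n) A τ hτ).trans hn)

theorem sum_range_mul_le_wsup (W : ℕ → ℝ≥0∞) {h : ι → ℝ≥0∞} {A : Finset ι} {η : ℝ≥0∞}
    (hA : ∀ i ∈ A, η ≤ h i) : (∑ k ∈ Finset.range A.card, W k) * η ≤ wsup W h := by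
  classical
  have e := A.equivFin
  -- Numbering `A` by `0, …, A.card - 1` uses exactly the `A.card` largest weights when `W`
  -- decreases.
  set τ : ι → ℕ := fun i => if hi : i ∈ A then (e ⟨i, hi⟩ : ℕ) else 0
  have hτ : Set.InjOn τ (A : Set ι) := by
    intro i hi j hj hij
    simp only [Finset.mem_coe] at hi hj
    simp only [τ, hi, hj, dif_pos] at hij
    simpa using e.injective (Fin.ext hij)
  have him : A.image τ = Finset.range A.card := by
    refine Finset.eq_of_subset_of_card_le (fun k hk => ?_) ?_
    · obtain ⟨i, hi, rfl⟩ := Finset.mem_image.1 hk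
      simp [τ, hi]
    · rw [Finset.card_image_of_injOn hτ, Finset.card_range]
  rw [← him, Finset.sum_image hτ, Finset.sum_mul]
  exact (Finset.sum_le_sum fun i hi => mul_le_mul_right (hA i hi) _).trans (sum_le_wsup W h A τ hτ)

theorem finite_le_of_wsup_ne_top (hW : ∑' k, W k = ∞) {h : ι → ℝ≥0∞} (hh : wsup W h ≠ ∞)
    {η : ℝ≥0∞} (hη : η ≠ 0) : {i | η ≤ h i}.Finite := by
  by_contra hinf
  refine hh (top_le_iff.1 ?_)
  have h1 : Tendsto (fun n => (∑ k ∈ Finset.range n, W k) * η) atTop (𝓝 (∞ * η)) :=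
    ENNReal.Tendsto.mul_const (hW ▸ ENNReal.tendsto_nat_tsum W) (Or.inl (by simp))
  rw [ENNReal.top_mul hη] at h1
  refine le_of_tendsto' h1 fun n => ?_
  obtain ⟨A, hA, rfl⟩ := Set.Infinite.exists_subset_card_eq hinf n
  exact sum_range_mul_le_wsup W fun i hi => hA hi

/-- Absolute continuity: the part of `h` away from a suitable finite set is negligible. It plays the
role of density of finitely supported sequences, and the divergence of `∑ W` is essential. -/
theorem exists_finset_wsup_le (hW : ∑' k, W k = ∞) (hW1 : ∀ k, W k ≤ 1) {h : ι → ℝ≥0∞}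
    (hh : wsup W h ≠ ∞) {ε : ℝ≥0∞} (hε : ε ≠ 0) :
    ∃ A : Finset ι, ∀ g : ι → ℝ≥0∞, (∀ i ∈ A, g i = 0) → (∀ i, g i ≤ h i) → wsup W g ≤ ε := by
  classical
  have hε2 : ε / 2 ≠ 0 := by simpa using hε
  -- A nearly optimal finite configuration. It uses only weights below some `M`; `η` is so small
  -- that `M` terms of size `η` are harmless, and the finitely many indices with `h i ≥ η` join the
  -- exceptional set.
  obtain ⟨A₀, τ₀, hτ₀, h0⟩ : ∃ (A : Finset ι) (τ : ι → ℕ), Set.InjOn τ (A : Set ι) ∧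
      wsup W h ≤ (∑ i ∈ A, W (τ i) * h i) + ε / 2 := by
    rcases eq_or_ne (wsup W h) 0 with h0 | h0
    · exact ⟨∅, fun _ => 0, by simp, by simp [h0]⟩
    · have h1 := ENNReal.sub_lt_self hh h0 hε2
      conv_rhs at h1 => rw [wsup]
      simp only [lt_iSup_iff] at h1
      obtain ⟨A, τ, hτ, h1⟩ := h1
      exact ⟨A, τ, hτ, tsub_le_iff_right.1 h1.le⟩
  obtain ⟨M, hM⟩ : ∃ M : ℕ, ∀ i ∈ A₀, τ₀ i < M :=
    ⟨(A₀.sup τ₀) + 1, fun i hi => Nat.lt_succ_of_le (Finset.le_sup hi)⟩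
  obtain ⟨η, hη, hMη⟩ : ∃ η : ℝ≥0∞, η ≠ 0 ∧ M * η ≤ ε / 2 := by
    refine ⟨ε / 2 / (M + 1), by simp [hε], ?_⟩
    calc (M : ℝ≥0∞) * (ε / 2 / (M + 1)) ≤ (M + 1) * (ε / 2 / (M + 1)) := by
          gcongr; exact le_self_add
      _ ≤ ε / 2 := ENNReal.mul_div_le
  have hfin := finite_le_of_wsup_ne_top hW hh hη
  refine ⟨A₀ ∪ hfin.toFinset, fun g hg hgh => wsup_le fun B τ hτ => ?_⟩
  set B' := B.filter fun i => g i ≠ 0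
  have hgη : ∀ i, g i ≤ η := fun i => by
    by_cases hi : i ∈ A₀ ∪ hfin.toFinset
    · simp [hg i hi]
    · have : ¬ η ≤ h i := fun h' => hi (by simp [h'])
      exact (hgh i).trans (not_le.1 this).le
  have h1 : ∑ i ∈ B, W (τ i) * g i = ∑ i ∈ B', W (τ i) * g i := by
    rw [Finset.sum_filter]
    refine Finset.sum_congr rfl fun i _ => ?_
    by_cases hi : g i = 0 <;> simp [hi]
  have hτ' : Set.InjOn τ (B' : Set ι) := hτ.mono fun i hi => (Finset.mem_filter.1 hi).1
  rw [h1, ← Finset.sum_filter_add_sum_filter_not B' (fun i => τ i < M)]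
  have hlow : ∑ i ∈ B' with τ i < M, W (τ i) * g i ≤ ε / 2 := by
    calc ∑ i ∈ B' with τ i < M, W (τ i) * g i ≤ ∑ i ∈ B' with τ i < M, η :=
          Finset.sum_le_sum fun i _ => (mul_le_mul' (hW1 _) (hgη i)).trans (one_mul _).le
      _ = ((B'.filter fun i => τ i < M).card : ℝ≥0∞) * η := by simp
      _ ≤ M * η := by
        gcongr
        have := Finset.card_le_card_of_injOn (s := B'.filter fun i => τ i < M)
          (t := Finset.range M) τ (fun i hi => by simpa using (Finset.mem_filter.1 hi).2)
          (hτ'.mono fun i hi => (Finset.mem_filter.1 hi).1)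
        simpa using this
      _ ≤ ε / 2 := hMη
  have hdisj : Disjoint A₀ (B'.filter fun i => ¬ τ i < M) := by
    rw [Finset.disjoint_left]
    intro i hi hi'
    have := (Finset.mem_filter.1 (Finset.mem_filter.1 hi').1).2
    exact this (hg i (Finset.mem_union_left _ hi))
  have hhigh : ∑ i ∈ B' with ¬ τ i < M, W (τ i) * g i ≤ ε / 2 := by
    set B'' := B'.filter fun i => ¬ τ i < M
    -- Weights of index at least `M` are unused by `τ₀`, so both assignments can be glued.
    -- Near-optimality of `τ₀` leaves at most `ε / 2` for the added part.
    set σ : ι → ℕ := fun i => if i ∈ A₀ then τ₀ i else τ i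
    have hσ : Set.InjOn σ ((A₀ ∪ B'' : Finset ι) : Set ι) := by
      have hB : ∀ i ∈ B'', i ∉ A₀ ∧ M ≤ τ i ∧ i ∈ B' := fun i hi =>
        ⟨fun h' => Finset.disjoint_left.1 hdisj h' hi, not_lt.1 (Finset.mem_filter.1 hi).2,
          (Finset.mem_filter.1 hi).1⟩
      intro i hi j hj hij
      rcases Finset.mem_union.1 hi with hi | hi <;> rcases Finset.mem_union.1 hj with hj | hj
      · simp only [σ, hi, hj, if_true] at hij
        exact hτ₀ hi hj hij
      · have h2 := hB j hj
        simp only [σ, hi, h2.1, if_true, if_false] at hij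
        have := hM i hi
        lia
      · have h2 := hB i hi
        simp only [σ, hj, h2.1, if_true, if_false] at hij
        have := hM j hj
        lia
      · have h2 := hB i hi
        have h3 := hB j hj
        simp only [σ, h2.1, h3.1, if_false] at hij
        exact hτ' h2.2.2 h3.2.2 hij
    have h2 := sum_le_wsup W h _ σ hσ
    rw [Finset.sum_union hdisj] at h2
    have h3 : ∑ i ∈ A₀, W (σ i) * h i = ∑ i ∈ A₀, W (τ₀ i) * h i :=
      Finset.sum_congr rfl fun i hi => by simp [σ, hi]
    have h4 : ∑ i ∈ B'', W (τ i) * g i ≤ ∑ i ∈ B'', W (σ i) * h i :=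
      Finset.sum_le_sum fun i hi => by
        have := Finset.disjoint_right.1 hdisj hi
        simp only [σ, this, if_false]
        exact mul_le_mul_right (hgh i) _
    have hfin0 : ∑ i ∈ A₀, W (τ₀ i) * h i ≠ ∞ :=
      ne_top_of_le_ne_top hh (sum_le_wsup W h A₀ τ₀ hτ₀)
    rw [h3] at h2
    refine h4.trans ((ENNReal.add_le_add_iff_left hfin0).1 (h2.trans h0))
  calc _ ≤ ε / 2 + ε / 2 := add_le_add hlow hhigh
    _ = ε := ENNReal.add_halves ε

/-- A decreasing null weight is a superposition of indicators of initial segments, by telescoping `W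
m - W (m + 1)`. This reduces Abel summation to unweighted sums over finite sets. -/
theorem exists_eq_tsum_ite_of_antitone (hW : Antitone W) (hW0 : Tendsto W atTop (𝓝 0)) :
    ∃ δ : ℕ → ℝ≥0∞, ∀ k, W k = ∑' m, if k ≤ m then δ m else 0 := by
  refine ⟨fun m => W m - W (m + 1), fun k => ?_⟩
  generalize hs : (fun m => if k ≤ m then W m - W (m + 1) else 0) = s
  have h1 : ∀ n, W (k + n) + ∑ m ∈ Finset.range (k + n), s m = W k := by
    intro n
    induction n with
    | zero =>
      rw [Finset.sum_eq_zero, add_zero, add_zero]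
      intro m hm
      have := Finset.mem_range.1 hm
      rw [← hs]
      exact if_neg (by lia)
    | succ n ih =>
      have h2 : s (k + n) = W (k + n) - W (k + n + 1) := by
        rw [← hs]
        exact if_pos (by lia)
      have h6 : W (k + n + 1) ≤ W (k + n) := hW (Nat.le_succ (k + n))
      have h7 : W (k + n + 1) + (W (k + n) - W (k + n + 1)) = W (k + n) :=
        add_tsub_cancel_of_le h6
      rw [← add_assoc, Finset.sum_range_succ, h2, add_left_comm, h7, add_comm, ih]
  have hk : Tendsto (fun n => k + n) atTop atTop :=
    tendsto_atTop_mono (fun n => Nat.le_add_left n k) tendsto_id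
  have h3 : Tendsto (fun n => W (k + n)) atTop (𝓝 0) := hW0.comp hk
  have h4 : Tendsto (fun n => ∑ m ∈ Finset.range (k + n), s m) atTop (𝓝 (∑' m, s m)) :=
    (ENNReal.tendsto_nat_tsum s).comp hk
  have h5 := h3.add h4
  simp only [h1, zero_add] at h5
  exact tendsto_nhds_unique tendsto_const_nhds h5

/-- Abel summation against a weight decreasing to `0`. -/
theorem wsup_le_tsum (hW : Antitone W) (hW0 : Tendsto W atTop (𝓝 0))
    {h : ι → ℝ≥0∞} {H : ℕ → ℝ≥0∞}
    (hH : ∀ A : Finset ι, A.Nonempty → ∃ a ∈ A, h a ≤ H (A.card - 1)) :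
    wsup W h ≤ ∑' k, W k * H k := by
  classical
  -- Peeling off a small element at each stage bounds the sum over `A` by the first `A.card` values
  -- of `H`.
  have hsum : ∀ (n : ℕ) (A : Finset ι), A.card = n → ∑ i ∈ A, h i ≤ ∑ k ∈ Finset.range n, H k := by
    intro n
    induction n with
    | zero => intro A hA; simp [Finset.card_eq_zero.1 hA]
    | succ n ih =>
      intro A hA
      obtain ⟨a, ha, hle⟩ := hH A (Finset.card_pos.1 (by lia))
      rw [← Finset.sum_erase_add A _ ha, Finset.sum_range_succ]
      refine add_le_add (ih _ (by rw [Finset.card_erase_of_mem ha]; lia)) ?_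
      simpa [hA] using hle
  obtain ⟨δ, hδ⟩ := exists_eq_tsum_ite_of_antitone hW hW0
  refine wsup_le fun A τ hτ => ?_
  calc ∑ i ∈ A, W (τ i) * h i
      = ∑ i ∈ A, ∑' m, (if τ i ≤ m then δ m * h i else 0) := by
        refine Finset.sum_congr rfl fun i _ => ?_
        rw [hδ (τ i), ← ENNReal.tsum_mul_right]
        simp only [ite_mul, zero_mul]
    _ = ∑' m, ∑ i ∈ A, (if τ i ≤ m then δ m * h i else 0) := by
        rw [Summable.tsum_finsetSum fun _ _ => ENNReal.summable]
    _ = ∑' m, δ m * ∑ i ∈ A with τ i ≤ m, h i := by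
        refine tsum_congr fun m => ?_
        rw [← Finset.sum_filter, Finset.mul_sum]
    -- Injectivity of `τ` allows at most `m + 1` indices with `τ i ≤ m`.
    _ ≤ ∑' m, δ m * ∑ k ∈ Finset.range (m + 1), H k := by
        refine ENNReal.tsum_le_tsum fun m => mul_le_mul_right ?_ _
        refine (hsum _ _ rfl).trans (Finset.sum_le_sum_of_subset ?_)
        rw [Finset.range_subset_range]
        have := Finset.card_le_card_of_injOn (s := A.filter fun i => τ i ≤ m)
          (t := Finset.range (m + 1)) τ
          (fun i hi => by simpa [Nat.lt_succ_iff] using (Finset.mem_filter.1 hi).2)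
          (hτ.mono fun i hi => (Finset.mem_filter.1 hi).1)
        simpa using this
    _ = ∑' m, ∑' k, (if k ≤ m then δ m * H k else 0) := by
        refine tsum_congr fun m => ?_
        rw [Finset.mul_sum, tsum_eq_sum (s := Finset.range (m + 1))]
        · refine Finset.sum_congr rfl fun k hk => ?_
          rw [if_pos (by simpa [Nat.lt_succ_iff] using hk)]
        · intro k hk
          rw [if_neg (by simpa [Nat.lt_succ_iff] using hk)]
    _ = ∑' k, ∑' m, (if k ≤ m then δ m * H k else 0) := ENNReal.tsum_comm
    _ = ∑' k, W k * H k := by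
        refine tsum_congr fun k => ?_
        conv_rhs => rw [hδ k, ← ENNReal.tsum_mul_right]
        simp only [ite_mul, zero_mul]

theorem wsup_le_tsum_of_antitone (hW : Antitone W) (hW0 : Tendsto W atTop (𝓝 0))
    {g : ℕ → ℝ≥0∞} (hg : Antitone g) : wsup W g ≤ ∑' k, W k * g k := by
  refine wsup_le_tsum hW hW0 fun A hA => ⟨A.max' hA, A.max'_mem hA, hg ?_⟩
  have : A ⊆ Finset.range (A.max' hA + 1) := fun i hi => by
    simpa [Nat.lt_succ_iff] using A.le_max' i hi
  have := Finset.card_le_card this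
  rw [Finset.card_range] at this
  lia

end wsup

/-! ### Bases of complete groups with a homogeneous norm -/

section NormedBasis

variable {𝕜 X : Type*} [RCLike 𝕜] [NormedAddCommGroup X] [Module 𝕜 X]

/-- The norm here is the `r`-th power of a quasi-norm, hence homogeneous of degree `r` only;
continuity of scaling has to be recovered from that. -/
theorem continuousConstSMul_of_norm_smul {r : ℝ}
    (hsm : ∀ (c : 𝕜) (v : X), ‖c • v‖ = ‖c‖ ^ r * ‖v‖) : ContinuousConstSMul 𝕜 X where
  continuous_const_smul c :=
    AddMonoidHomClass.continuous_of_bound (DistribSMul.toAddMonoidHom X c) (‖c‖ ^ r)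
      fun v => (hsm c v).le

theorem continuous_smul_const_of_norm_smul {r : ℝ} (hr : 0 < r)
    (hsm : ∀ (c : 𝕜) (v : X), ‖c • v‖ = ‖c‖ ^ r * ‖v‖) (v : X) :
    Continuous fun c : 𝕜 => c • v := by
  refine continuous_iff_continuousAt.2 fun c₀ => ?_
  rw [ContinuousAt, tendsto_iff_norm_sub_tendsto_zero]
  simp only [← sub_smul, hsm]
  have h1 : Continuous fun c : 𝕜 => ‖c - c₀‖ ^ r * ‖v‖ := by
    refine (Continuous.rpow_const (by fun_prop) fun _ => Or.inr hr.le).mul continuous_const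
  have h2 := h1.tendsto c₀
  simpa [Real.zero_rpow hr.ne'] using h2

/-- `v` is the sum of the series `∑ j, a j • x j`. -/
def HasExpansion (x : ℕ → X) (a : ℕ → 𝕜) (v : X) : Prop :=
  Tendsto (fun n => ∑ j ∈ Finset.range n, a j • x j) atTop (𝓝 v)

theorem HasExpansion.add {x : ℕ → X} {a b : ℕ → 𝕜} {u v : X} (hu : HasExpansion x a u)
    (hv : HasExpansion x b v) : HasExpansion x (a + b) (u + v) := by
  have := Tendsto.add hu hv
  simpa only [HasExpansion, Pi.add_apply, add_smul, Finset.sum_add_distrib] using this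

theorem HasExpansion.neg {x : ℕ → X} {a : ℕ → 𝕜} {u : X} (hu : HasExpansion x a u) :
    HasExpansion x (-a) (-u) := by
  have := Tendsto.neg hu
  simpa only [HasExpansion, Pi.neg_apply, neg_smul, Finset.sum_neg_distrib] using this

theorem HasExpansion.sub {x : ℕ → X} {a b : ℕ → 𝕜} {u v : X} (hu : HasExpansion x a u)
    (hv : HasExpansion x b v) : HasExpansion x (a - b) (u - v) := by
  simpa only [sub_eq_add_neg] using hu.add hv.neg

theorem HasExpansion.smul [ContinuousConstSMul 𝕜 X] {x : ℕ → X} {a : ℕ → 𝕜} {u : X}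
    (hu : HasExpansion x a u) (c : 𝕜) : HasExpansion x (c • a) (c • u) := by
  have := Tendsto.const_smul hu c
  simpa only [HasExpansion, Pi.smul_apply, smul_assoc, Finset.smul_sum] using this

theorem HasExpansion.add_seq {x y : ℕ → X} {a : ℕ → 𝕜} {u v : X} (hu : HasExpansion x a u)
    (hv : HasExpansion y a v) : HasExpansion (fun j => x j + y j) a (u + v) := by
  have := Tendsto.add hu hv
  simpa only [HasExpansion, smul_add, Finset.sum_add_distrib] using this

theorem HasExpansion.neg_seq {x : ℕ → X} {a : ℕ → 𝕜} {u : X} (hu : HasExpansion x a u) :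
    HasExpansion (fun j => -x j) a (-u) := by
  have := Tendsto.neg hu
  simpa only [HasExpansion, smul_neg, Finset.sum_neg_distrib] using this

theorem hasExpansion_zero (x : ℕ → X) : HasExpansion x (0 : ℕ → 𝕜) 0 := by
  simp [HasExpansion]

theorem hasExpansion_single (x : ℕ → X) (i : ℕ) (c : 𝕜) :
    HasExpansion x (Pi.single i c) (c • x i) := by
  refine tendsto_const_nhds.congr' ?_
  filter_upwards [eventually_gt_atTop i] with n hn
  rw [Finset.sum_eq_single i]
  · simp
  · intro j _ hj
    simp [hj]
  · intro h
    exact absurd (Finset.mem_range.2 hn) h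

theorem HasExpansion.mem_closure {x : ℕ → X} {a : ℕ → 𝕜} {u : X} (hu : HasExpansion x a u) :
    u ∈ closure (Submodule.span 𝕜 (Set.range x) : Set X) :=
  mem_closure_of_tendsto hu (Eventually.of_forall fun _ => Submodule.sum_mem _ fun j _ =>
    Submodule.smul_mem _ _ (Submodule.subset_span ⟨j, rfl⟩))

/-- `x` is a Schauder basis of its closed linear span. -/
def IsNormedBasic (𝕜 : Type*) {X : Type*} [RCLike 𝕜] [NormedAddCommGroup X] [Module 𝕜 X]
    (x : ℕ → X) : Prop :=
  ∀ v ∈ closure (Submodule.span 𝕜 (Set.range x) : Set X), ∃! a : ℕ → 𝕜, HasExpansion x a v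

theorem IsNormedBasic.unique {x : ℕ → X} (hx : IsNormedBasic 𝕜 x) {a b : ℕ → 𝕜} {v : X}
    (ha : HasExpansion x a v) (hb : HasExpansion x b v) : a = b :=
  (hx v ha.mem_closure).unique ha hb

theorem IsNormedBasic.ne_zero {x : ℕ → X} (hx : IsNormedBasic 𝕜 x) (i : ℕ) : x i ≠ 0 := by
  intro h
  have h1 := hasExpansion_single x i (1 : 𝕜)
  rw [h, smul_zero] at h1
  have h2 := congrFun (hx.unique h1 (hasExpansion_zero x)) i
  simp at h2

/-! ### Bounds for coefficients and partial sums. -/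

theorem norm_coeff_le {r : ℝ} (hsm : ∀ (c : 𝕜) (v : X), ‖c • v‖ = ‖c‖ ^ r * ‖v‖) {x : ℕ → X}
    {a : ℕ → 𝕜} {C : ℝ} (hC : ∀ n, ‖∑ j ∈ Finset.range n, a j • x j‖ ≤ C) (i : ℕ) :
    ‖a i‖ ^ r * ‖x i‖ ≤ 2 * C := by
  have h1 : a i • x i = ∑ j ∈ Finset.range (i + 1), a j • x j - ∑ j ∈ Finset.range i, a j • x j := by
    rw [Finset.sum_range_succ, add_sub_cancel_left]
  rw [← hsm, h1, two_mul]
  exact (norm_sub_le _ _).trans (add_le_add (hC _) (hC _))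

/-- The Baire half of an open mapping argument: vectors whose partial sums are bounded by `m` are
dense in some ball, and differences recentre that ball at `0`. The estimate is obtained only up to
`ε`; the next result removes the error by iteration. -/
theorem IsNormedBasic.exists_approx [CompleteSpace X] {r : ℝ} (hr : 0 < r)
    (hsm : ∀ (c : 𝕜) (v : X), ‖c • v‖ = ‖c‖ ^ r * ‖v‖) {x : ℕ → X} (hx : IsNormedBasic 𝕜 x) :
    ∃ C : ℝ, 0 ≤ C ∧ ∀ v ∈ closure (Submodule.span 𝕜 (Set.range x) : Set X), ∀ ε : ℝ, 0 < ε →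
      ∃ (u : X) (a : ℕ → 𝕜), HasExpansion x a u ∧
        (∀ n, ‖∑ j ∈ Finset.range n, a j • x j‖ ≤ C * ‖v‖) ∧ ‖v - u‖ ≤ ε := by
  have := continuousConstSMul_of_norm_smul hsm
  set Y := (Submodule.span 𝕜 (Set.range x)).topologicalClosure
  have hYmem : ∀ v, v ∈ Y ↔ v ∈ closure (Submodule.span 𝕜 (Set.range x) : Set X) := fun v =>
    Iff.rfl
  have hYc : CompleteSpace Y := (Submodule.isClosed_topologicalClosure _).completeSpace_coe
  set A : ℕ → Set Y := fun m => {v | ∃ a : ℕ → 𝕜, HasExpansion x a (v : X) ∧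
    ∀ n, ‖∑ j ∈ Finset.range n, a j • x j‖ ≤ m}
  have hU : ⋃ m, closure (A m) = Set.univ := by
    refine Set.eq_univ_of_forall fun v => Set.mem_iUnion.2 ?_
    obtain ⟨a, ha, -⟩ := hx v v.2
    obtain ⟨B, hB⟩ := (Tendsto.norm ha).bddAbove_range
    obtain ⟨m, hm⟩ := exists_nat_ge B
    exact ⟨m, subset_closure ⟨a, ha, fun n => (hB ⟨n, rfl⟩).trans hm⟩⟩
  obtain ⟨m, v₀, hv₀⟩ := nonempty_interior_of_iUnion_of_closed (fun m => isClosed_closure) hU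
  obtain ⟨δ, hδ, hball⟩ := Metric.mem_nhds_iff.1 (mem_interior_iff_mem_nhds.1 hv₀)
  have step : ∀ v ∈ Y, ‖v‖ < δ → ∀ ε : ℝ, 0 < ε → ∃ (u : X) (a : ℕ → 𝕜), HasExpansion x a u ∧
      (∀ n, ‖∑ j ∈ Finset.range n, a j • x j‖ ≤ 2 * m) ∧ ‖v - u‖ ≤ ε := by
    intro v hv hvδ ε hε
    have h1 : v₀ + ⟨v, hv⟩ ∈ closure (A m) := hball (by simpa [Metric.mem_ball] using hvδ)
    have h2 : v₀ ∈ closure (A m) := hball (Metric.mem_ball_self hδ)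
    obtain ⟨u₁, ⟨a₁, ha₁, hb₁⟩, hd₁⟩ := Metric.mem_closure_iff.1 h1 (ε / 2) (by positivity)
    obtain ⟨u₂, ⟨a₂, ha₂, hb₂⟩, hd₂⟩ := Metric.mem_closure_iff.1 h2 (ε / 2) (by positivity)
    refine ⟨u₁ - u₂, a₁ - a₂, ha₁.sub ha₂, fun n => ?_, ?_⟩
    · simp only [Pi.sub_apply, sub_smul, Finset.sum_sub_distrib]
      rw [two_mul]
      exact (norm_sub_le _ _).trans (add_le_add (hb₁ n) (hb₂ n))
    · rw [Subtype.dist_eq, dist_eq_norm] at hd₁ hd₂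
      have h3 : v - ((u₁ : X) - u₂) = ((v₀ + ⟨v, hv⟩ : Y) - (u₁ : X)) - ((v₀ : X) - u₂) := by
        simp only [Submodule.coe_add]
        abel
      rw [h3]
      linarith [norm_sub_le (((v₀ + ⟨v, hv⟩ : Y) : X) - (u₁ : X)) ((v₀ : X) - u₂)]
  refine ⟨2 * m * (2 / δ), by positivity, fun v hv ε hε => ?_⟩
  rcases eq_or_ne v 0 with rfl | hv0
  · exact ⟨0, 0, hasExpansion_zero x, by simp, by simpa using hε.le⟩
  have hvp : 0 < ‖v‖ := norm_pos_iff.2 hv0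
  -- By homogeneity of degree `r`, multiplication by `t` brings `v` to norm `δ / 2`.
  set t : ℝ := (δ / (2 * ‖v‖)) ^ (1 / r)
  have ht : 0 < t := by positivity
  have htr : t ^ r = δ / (2 * ‖v‖) := by
    rw [← Real.rpow_mul (by positivity), one_div_mul_cancel hr.ne', Real.rpow_one]
  have htn : ∀ w : X, ‖(t : 𝕜) • w‖ = δ / (2 * ‖v‖) * ‖w‖ := fun w => by
    rw [hsm, RCLike.norm_ofReal, abs_of_pos ht, htr]
  have htn' : ∀ w : X, ‖(t : 𝕜)⁻¹ • w‖ = (2 * ‖v‖) / δ * ‖w‖ := fun w => by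
    rw [hsm, norm_inv, RCLike.norm_ofReal, abs_of_pos ht, Real.inv_rpow ht.le, htr, inv_div]
  have ht0 : (t : 𝕜) ≠ 0 := by exact_mod_cast ht.ne'
  obtain ⟨u, a, ha, hb, hd⟩ := step ((t : 𝕜) • v) (Y.smul_mem _ hv)
    (by rw [htn]; field_simp; linarith) (δ / (2 * ‖v‖) * ε) (by positivity)
  refine ⟨(t : 𝕜)⁻¹ • u, (t : 𝕜)⁻¹ • a, ha.smul _, fun n => ?_, ?_⟩
  · simp only [Pi.smul_apply, smul_assoc, ← Finset.smul_sum]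
    rw [htn']
    calc 2 * ‖v‖ / δ * ‖∑ j ∈ Finset.range n, a j • x j‖ ≤ 2 * ‖v‖ / δ * (2 * m) := by
          gcongr; exact hb n
      _ = 2 * m * (2 / δ) * ‖v‖ := by ring
  · have h3 : v - (t : 𝕜)⁻¹ • u = (t : 𝕜)⁻¹ • ((t : 𝕜) • v - u) := by
      rw [smul_sub, inv_smul_smul₀ ht0]
    rw [h3, htn']
    calc 2 * ‖v‖ / δ * ‖(t : 𝕜) • v - u‖ ≤ 2 * ‖v‖ / δ * (δ / (2 * ‖v‖) * ε) := by gcongr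
      _ = ε := by field_simp

/-- The partial sum projections of a basic sequence are uniformly bounded. -/
theorem IsNormedBasic.exists_norm_sum_le [CompleteSpace X] {r : ℝ} (hr : 0 < r)
    (hsm : ∀ (c : 𝕜) (v : X), ‖c • v‖ = ‖c‖ ^ r * ‖v‖) {x : ℕ → X} (hx : IsNormedBasic 𝕜 x) :
    ∃ C : ℝ, ∀ (v : X) (a : ℕ → 𝕜), HasExpansion x a v →
      ∀ n, ‖∑ j ∈ Finset.range n, a j • x j‖ ≤ C * ‖v‖ := by
  obtain ⟨C, hC0, hC⟩ := hx.exists_approx hr hsm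
  refine ⟨C * 2, fun v a₀ ha₀ n => ?_⟩
  have := continuousConstSMul_of_norm_smul hsm
  set Y := (Submodule.span 𝕜 (Set.range x)).topologicalClosure
  rcases eq_or_ne v 0 with rfl | hv0
  · rw [hx.unique ha₀ (hasExpansion_zero x)]
    simp
  have hvp : 0 < ‖v‖ := norm_pos_iff.2 hv0
  -- Positivity of `ε` is moved inside the existential, with a dummy choice otherwise, so that the
  -- chosen `U` and `c` depend on `z` and `ε` alone and can be iterated.
  have hC' : ∀ (z : Y) (ε : ℝ), ∃ (u : Y) (a : ℕ → 𝕜), 0 < ε → HasExpansion x a (u : X) ∧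
      (∀ n, ‖∑ j ∈ Finset.range n, a j • x j‖ ≤ C * ‖z‖) ∧ ‖z - u‖ ≤ ε := by
    intro z ε
    by_cases hε : 0 < ε
    · obtain ⟨u, a, h1, h2, h3⟩ := hC z z.2 ε hε
      exact ⟨⟨u, h1.mem_closure⟩, a, fun _ => ⟨h1, h2, h3⟩⟩
    · exact ⟨0, 0, fun h => absurd h hε⟩
  choose U c hUc using hC'
  -- Successive remainders: each step approximates the current one so well that its norm is at most
  -- `‖v‖ / 2 ^ k` at stage `k`.
  let z : ℕ → Y := fun k => Nat.rec ⟨v, ha₀.mem_closure⟩ (fun k y => y - U y (‖v‖ / 2 / 2 ^ k)) k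
  have hz0 : z 0 = ⟨v, ha₀.mem_closure⟩ := rfl
  have hzs : ∀ k, z (k + 1) = z k - U (z k) (‖v‖ / 2 / 2 ^ k) := fun k => rfl
  clear_value z
  set u : ℕ → X := fun k => (U (z k) (‖v‖ / 2 / 2 ^ k) : X)
  set a : ℕ → ℕ → 𝕜 := fun k => c (z k) (‖v‖ / 2 / 2 ^ k)
  have hu : ∀ k, HasExpansion x (a k) (u k) := fun k => (hUc (z k) _ (by positivity)).1
  have hzn : ∀ k, ‖z k‖ ≤ ‖v‖ / 2 ^ k := by
    intro k
    cases k with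
    | zero => simp [hz0]
    | succ k =>
      rw [hzs]
      refine (hUc (z k) _ (by positivity)).2.2.trans (le_of_eq ?_)
      rw [pow_succ]
      field_simp
  have ha : ∀ k n, ‖∑ j ∈ Finset.range n, a k j • x j‖ ≤ C * ‖v‖ / 2 ^ k := fun k n => by
    refine ((hUc (z k) _ (by positivity)).2.1 n).trans ?_
    rw [mul_div_assoc]
    exact mul_le_mul_of_nonneg_left (hzn k) hC0
  have hgeo : HasSum (fun k : ℕ => C * ‖v‖ / 2 ^ k) (C * ‖v‖ * 2) := by
    have := hasSum_geometric_two.mul_left (C * ‖v‖)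
    simpa only [one_div, inv_pow, ← div_eq_mul_inv] using this
  have hun : ∀ k, ‖u k‖ ≤ C * ‖v‖ / 2 ^ k := fun k =>
    le_of_tendsto' (Tendsto.norm (hu k)) fun n => ha k n
  have husum : Summable u := Summable.of_norm_bounded hgeo.summable hun
  have hupart : ∀ K, ∑ k ∈ Finset.range K, u k = v - z K := by
    intro K
    induction K with
    | zero => simp [hz0]
    | succ K ih =>
      rw [Finset.sum_range_succ, ih, hzs]
      simp only [AddSubgroupClass.coe_sub, u]
      abel
  have hutsum : ∑' k, u k = v := by
    refine tendsto_nhds_unique husum.hasSum.tendsto_sum_nat ?_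
    simp only [hupart]
    rw [tendsto_iff_norm_sub_tendsto_zero]
    have h2 : Tendsto (fun k : ℕ => ‖v‖ / 2 ^ k) atTop (𝓝 0) :=
      tendsto_const_nhds.div_atTop (tendsto_pow_atTop_atTop_of_one_lt one_lt_two)
    refine squeeze_zero (fun _ => norm_nonneg _) (fun k => ?_) h2
    simpa using hzn k
  have hcoef : ∀ i, Summable fun k => a k i := by
    intro i
    have hxi : 0 < ‖x i‖ := norm_pos_iff.2 (hx.ne_zero i)
    refine Summable.of_norm_bounded (g := fun k : ℕ => (2 * (C * ‖v‖) / ‖x i‖) ^ (1 / r) *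
      ((1 / 2 : ℝ) ^ (1 / r)) ^ k) ?_ fun k => ?_
    · refine Summable.mul_left _ (summable_geometric_of_lt_one (by positivity) ?_)
      exact Real.rpow_lt_one (by norm_num) (by norm_num) (by positivity)
    · have h1 := norm_coeff_le hsm (ha k) i
      have h2 : ‖a k i‖ ^ r ≤ 2 * (C * ‖v‖) / ‖x i‖ * (1 / 2) ^ k := by
        rw [div_mul_eq_mul_div, le_div_iff₀ hxi]
        refine h1.trans (le_of_eq ?_)
        rw [one_div, inv_pow, div_eq_mul_inv]
        ring
      have h3 : ‖a k i‖ = (‖a k i‖ ^ r) ^ (1 / r) := by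
        rw [← Real.rpow_mul (norm_nonneg _), mul_one_div_cancel hr.ne', Real.rpow_one]
      rw [h3, Real.rpow_pow_comm (by norm_num), ← Real.mul_rpow (by positivity) (by positivity)]
      exact Real.rpow_le_rpow (by positivity) h2 (by positivity)
  -- Summing the coefficients of all the approximants gives an expansion of `v`, by dominated
  -- convergence; uniqueness identifies it with `a₀`.
  set b : ℕ → 𝕜 := fun i => ∑' k, a k i
  have hS : ∀ n, HasSum (fun k => ∑ j ∈ Finset.range n, a k j • x j)
      (∑ j ∈ Finset.range n, b j • x j) := by
    intro n
    refine hasSum_sum fun j _ => ?_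
    exact (hcoef j).hasSum.map ((smulAddHom 𝕜 X).flip (x j))
      (continuous_smul_const_of_norm_smul hr hsm (x j))
  have hb : HasExpansion x b v := by
    have h1 := tendsto_tsum_of_dominated_convergence (𝓕 := atTop)
      (f := fun n k => ∑ j ∈ Finset.range n, a k j • x j) (g := u) hgeo.summable hu
      (Eventually.of_forall fun n k => ha k n)
    rw [hutsum] at h1
    refine h1.congr fun n => (hS n).tsum_eq
  rw [hx.unique ha₀ hb, ← (hS n).tsum_eq]
  refine (tsum_of_norm_bounded hgeo fun k => ha k n).trans (le_of_eq (by ring))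

/-- If all rearrangements of `x` are basic, convergent expansions can be rearranged. -/
theorem HasExpansion.comp_perm [CompleteSpace X] {r : ℝ} (hr : 0 < r)
    (hsm : ∀ (c : 𝕜) (v : X), ‖c • v‖ = ‖c‖ ^ r * ‖v‖) {x : ℕ → X} (hx : IsNormedBasic 𝕜 x)
    (π : Equiv.Perm ℕ) (hπ : IsNormedBasic 𝕜 (fun j => x (π j))) {a : ℕ → 𝕜} {v : X}
    (ha : HasExpansion x a v) : HasExpansion (fun j => x (π j)) (fun j => a (π j)) v := by
  have hr' : Set.range (fun j => x (π j)) = Set.range x := π.surjective.range_comp x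
  obtain ⟨b, hb, -⟩ := hπ v (by rw [hr']; exact ha.mem_closure)
  obtain ⟨C, hC⟩ := hx.exists_norm_sum_le hr hsm
  suffices h : (fun j => a (π j)) = b by rw [h]; exact hb
  funext i
  -- `T n` is a finite combination of the `x j`. For `n > i` its coefficient at `π i` is `b i`, and
  -- the coefficient of `v - T n` there is controlled by `‖v - T n‖`, which tends to `0`.
  set T : ℕ → X := fun n => ∑ j ∈ Finset.range n, b j • x (π j)
  have hT : ∀ n, HasExpansion x (∑ j ∈ Finset.range n, Pi.single (π j) (b j)) (T n) := by
    intro n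
    induction n with
    | zero => simpa [T] using hasExpansion_zero x
    | succ n ih =>
      simp only [T, Finset.sum_range_succ]
      exact ih.add (hasExpansion_single x _ _)
  have hval : ∀ n, i < n →
      (∑ j ∈ Finset.range n, (Pi.single (π j) (b j) : ℕ → 𝕜)) (π i) = b i := by
    intro n hn
    rw [Finset.sum_apply, Finset.sum_eq_single i]
    · simp
    · intro j _ hj
      simp [hj.symm]
    · intro h
      exact absurd (Finset.mem_range.2 hn) h
  have h1 : Tendsto (fun n => 2 * (C * ‖v - T n‖)) atTop (𝓝 0) := by
    have h2 : Tendsto (fun n => ‖v - T n‖) atTop (𝓝 0) := by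
      have := (tendsto_const_nhds (x := v)).sub hb
      rw [sub_self] at this
      simpa using this.norm
    simpa using (h2.const_mul C).const_mul 2
  have h3 : ‖a (π i) - b i‖ ^ r * ‖x (π i)‖ ≤ 0 := by
    refine ge_of_tendsto h1 ?_
    filter_upwards [eventually_gt_atTop i] with n hn
    have h4 := norm_coeff_le hsm (hC _ _ (ha.sub (hT n))) (π i)
    rwa [Pi.sub_apply, hval n hn] at h4
  rw [← hsm] at h3
  have h5 := norm_le_zero_iff.1 h3
  exact sub_eq_zero.1 ((smul_eq_zero.1 h5).resolve_right (hx.ne_zero _))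

end NormedBasis

/-! ### Unconditional convergence -/

/-- Listing `ℕ` by increasing key `κ` turns every sublevel set of `κ` into an initial segment of the
rearrangement, so a permutation can be prescribed by its keys. -/
theorem exists_perm_image_range_eq {κ : ℕ → ℕ} (hκ : Function.Injective κ) :
    ∃ π : Equiv.Perm ℕ, ∀ c : ℕ, ∃ n : ℕ, ∀ i, i ∈ (Finset.range n).image π ↔ κ i < c := by
  classical
  have hinf : (Set.range κ).Infinite := Set.infinite_range_of_injective hκ
  have := hinf.to_subtype
  let e := Nat.Subtype.orderIsoOfNat (Set.range κ)
  let k := Equiv.ofInjective κ hκ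
  refine ⟨e.toEquiv.trans k.symm, fun c => ?_⟩
  have hk : ∀ i, κ i = (e (e.symm (k i)) : ℕ) := fun i => by simp [k]
  by_cases hc : ∃ n, c ≤ (e n : ℕ)
  · refine ⟨Nat.find hc, fun i => ?_⟩
    have hmem : i ∈ (Finset.range (Nat.find hc)).image (e.toEquiv.trans k.symm) ↔
        e.symm (k i) < Nat.find hc := by
      constructor
      · intro h
        obtain ⟨j, hj, rfl⟩ := Finset.mem_image.1 h
        simpa using hj
      · intro h
        exact Finset.mem_image.2 ⟨e.symm (k i), Finset.mem_range.2 h, by simp⟩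
    rw [hmem, hk i]
    constructor
    · intro h
      exact not_le.1 (Nat.find_min hc h)
    · intro h
      by_contra hcon
      have h1 : e (Nat.find hc) ≤ e (e.symm (k i)) := e.monotone (not_lt.1 hcon)
      exact absurd (Nat.find_spec hc) (not_le.2 (lt_of_le_of_lt (by exact_mod_cast h1) h))
  · exfalso
    push Not at hc
    refine hinf ((Set.finite_lt_nat c).subset ?_)
    rintro _ ⟨i, rfl⟩
    rw [hk i]
    exact hc _

/-- If all rearrangements of a series converge, it converges unconditionally. -/
theorem summable_of_forall_perm {X : Type*} [NormedAddCommGroup X] [CompleteSpace X] {f : ℕ → X}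
    (hf : ∀ π : Equiv.Perm ℕ, ∃ v, Tendsto (fun n => ∑ j ∈ Finset.range n, f (π j)) atTop (𝓝 v)) :
    Summable f := by
  classical
  by_contra hns
  rw [summable_iff_vanishing_norm] at hns
  push Not at hns
  obtain ⟨ε, hε, hns⟩ := hns
  choose t htd ht using fun m : ℕ => hns (Finset.range m)
  let N : ℕ → ℕ := fun m => max (m + 1) ((t m).sup id + 1)
  have hN : ∀ m, m < N m := fun m => lt_of_lt_of_le (Nat.lt_succ_self m) (le_max_left _ _)
  have htN : ∀ m, ∀ i ∈ t m, m ≤ i ∧ i < N m := fun m i hi => by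
    constructor
    · by_contra h
      exact Finset.disjoint_left.1 (htd m) hi (Finset.mem_range.2 (not_le.1 h))
    · exact lt_of_lt_of_le (Nat.lt_succ_of_le (Finset.le_sup (f := id) hi)) (le_max_right _ _)
  let M : ℕ → ℕ := fun k => N^[k] 0
  have hMs : ∀ k, M (k + 1) = N (M k) := fun k => Function.iterate_succ_apply' N k 0
  have hM : StrictMono M := strictMono_nat_of_lt_succ fun k => by rw [hMs]; exact hN _
  have hM0 : M 0 = 0 := rfl
  have hblock : ∀ i, ∃ k, M k ≤ i ∧ i < M (k + 1) := by
    intro i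
    have hex : ∃ k, i < M (k + 1) := ⟨i, lt_of_lt_of_le (Nat.lt_succ_self i) (hM.id_le _)⟩
    refine ⟨Nat.find hex, ?_, Nat.find_spec hex⟩
    rcases Nat.eq_zero_or_pos (Nat.find hex) with h | h
    · rw [h, hM0]; exact Nat.zero_le _
    · have := Nat.find_min hex (Nat.sub_lt h Nat.one_pos)
      rw [Nat.sub_add_cancel h] at this
      exact not_lt.1 this
  choose K hK1 hK2 using hblock
  have hKu : ∀ i k, M k ≤ i → i < M (k + 1) → K i = k := by
    intro i k h1 h2
    by_contra hne
    rcases lt_or_gt_of_ne hne with h | h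
    · have := hM.monotone (show K i + 1 ≤ k from h)
      have := hK2 i
      lia
    · have := hM.monotone (show k + 1 ≤ K i from h)
      have := hK1 i
      lia
  -- Inside block `k`, the indices in `t (M k)` come before the others. Cutting the keys at `2 * M
  -- k` and at `M k + M (k + 1)` gives initial segments differing exactly by `t (M k)`, so the
  -- partial sums are not Cauchy.
  let κ : ℕ → ℕ := fun i => if i ∈ t (M (K i)) then M (K i) + i else M (K i + 1) + i
  have hκlt : ∀ i, 2 * M (K i) ≤ κ i ∧ κ i < 2 * M (K i + 1) := by
    intro i
    have h1 := hK1 i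
    have h2 := hK2 i
    have h3 := hM (Nat.lt_succ_self (K i))
    simp only [κ]
    split_ifs <;> constructor <;> lia
  have hκ : Function.Injective κ := by
    intro i j hij
    have hKK : K i = K j := by
      by_contra hne
      have hi := hκlt i
      have hj := hκlt j
      rcases lt_or_gt_of_ne hne with h | h
      · have := hM.monotone (show K i + 1 ≤ K j from h)
        lia
      · have := hM.monotone (show K j + 1 ≤ K i from h)
        lia
    have h1 := hK1 i
    have h2 := hK2 i
    have h3 := hK1 j
    have h4 := hK2 j
    simp only [κ, hKK] at hij h1 h2
    split_ifs at hij <;> lia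
  obtain ⟨π, hπ⟩ := exists_perm_image_range_eq hκ
  obtain ⟨v, hv⟩ := hf π
  choose n hn using hπ
  have hsum : ∀ c, ∑ j ∈ Finset.range (n c), f (π j) = ∑ i ∈ (Finset.range (n c)).image π, f i :=
    fun c => (Finset.sum_image π.injective.injOn).symm
  have hcard : ∀ c, n c = ((Finset.range (n c)).image π).card := fun c => by
    rw [Finset.card_image_of_injective _ π.injective, Finset.card_range]
  have hlow : ∀ k, (Finset.range (n (2 * M k))).image π = Finset.range (M k) := by
    intro k
    ext i
    rw [hn, Finset.mem_range]
    have h1 := hκlt i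
    constructor
    · intro h
      have h2 : K i < k := by
        by_contra hcon
        have := hM.monotone (not_lt.1 hcon)
        lia
      exact lt_of_lt_of_le (hK2 i) (hM.monotone h2)
    · intro h
      have h2 : K i < k := by
        by_contra hcon
        have := hM.monotone (not_lt.1 hcon)
        have := hK1 i
        lia
      have := hM.monotone (show K i + 1 ≤ k from h2)
      lia
  have hmid : ∀ k, (Finset.range (n (M k + M (k + 1)))).image π =
      Finset.range (M k) ∪ t (M k) := by
    intro k
    ext i
    rw [hn, Finset.mem_union, Finset.mem_range]
    have h1 := hκlt i
    have h3 := hM (Nat.lt_succ_self k)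
    constructor
    · intro h
      have h2 : K i ≤ k := by
        by_contra hcon
        have := hM.monotone (show k + 1 ≤ K i from not_le.1 hcon)
        lia
      rcases h2.lt_or_eq with h2 | h2
      · exact Or.inl (lt_of_lt_of_le (hK2 i) (hM.monotone h2))
      · right
        by_contra hcon
        have h4 : κ i = M (k + 1) + i := by simp only [κ, h2, hcon, if_false]
        have := hK1 i
        rw [h2] at this
        lia
    · rintro (h | h)
      · have h2 : K i < k := by
          by_contra hcon
          have := hM.monotone (not_lt.1 hcon)
          have := hK1 i
          lia
        have := hM.monotone (show K i + 1 ≤ k from h2)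
        lia
      · have h4 := htN _ i h
        rw [← hMs] at h4
        have h2 := hKu i k h4.1 h4.2
        have h5 : κ i = M k + i := by simp only [κ, h2, h, if_true]
        lia
  have hnlow : ∀ k, n (2 * M k) = M k := fun k => by rw [hcard, hlow, Finset.card_range]
  have hnmid : ∀ k, M k ≤ n (M k + M (k + 1)) := fun k => by
    rw [hcard, hmid]
    calc M k = (Finset.range (M k)).card := (Finset.card_range _).symm
      _ ≤ _ := Finset.card_le_card Finset.subset_union_left
  have hMt : Tendsto M atTop atTop := hM.tendsto_atTop
  have h1 : Tendsto (fun k => n (2 * M k)) atTop atTop := by simpa only [hnlow] using hMt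
  have h2 : Tendsto (fun k => n (M k + M (k + 1))) atTop atTop := tendsto_atTop_mono hnmid hMt
  have h3 := ((hv.comp h2).sub (hv.comp h1)).norm
  rw [sub_self, norm_zero] at h3
  have h4 : ∀ k, ε ≤ ‖∑ j ∈ Finset.range (n (M k + M (k + 1))), f (π j) -
      ∑ j ∈ Finset.range (n (2 * M k)), f (π j)‖ := by
    intro k
    rw [hsum, hsum, hlow, hmid, Finset.sum_union (htd _).symm, add_sub_cancel_left]
    exact ht _
  exact absurd (ge_of_tendsto' h3 h4) (not_le.2 hε)

/-! ### Series in a complete quasi-normed space -/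

section QuasiNormSeries

variable {𝕜 X : Type*} [RCLike 𝕜] [AddCommGroup X] [Module 𝕜 X]

/-- A quasi-norm with a subadditive power induces a translation-invariant norm. -/
noncomputable abbrev VecQuasiNorm.normedAddCommGroup (q : VecQuasiNorm 𝕜 X) {r : ℝ} (hr : 0 < r)
    (hsub : ∀ u v, q.toFun (u + v) ^ r ≤ q.toFun u ^ r + q.toFun v ^ r) : NormedAddCommGroup X :=
  AddGroupNorm.toNormedAddCommGroup
    { toFun := fun v => q.toFun v ^ r
      map_zero' := by rw [(q.eq_zero_iff 0).2 rfl, Real.zero_rpow hr.ne']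
      add_le' := hsub
      neg' := fun v => by
        have h := q.smul_eq (-1) v
        rw [neg_one_smul, norm_neg, norm_one, one_mul] at h
        rw [h]
      eq_zero_of_map_eq_zero' := fun v hv =>
        (q.eq_zero_iff v).1 ((Real.rpow_eq_zero (q.nonneg v) hr.ne').1 hv) }

/-- A quasi-norm is complete if its Cauchy sequences converge. -/
def VecQuasiNorm.IsComplete (q : VecQuasiNorm 𝕜 X) : Prop :=
  ∀ u : ℕ → X, (∀ ε : ℝ, 0 < ε → ∃ N, ∀ m ≥ N, ∀ n ≥ N, q.toFun (u m - u n) < ε) →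
    ∃ v, Tendsto (fun n => q.toFun (v - u n)) atTop (𝓝 0)

variable {q : VecQuasiNorm 𝕜 X} {r : ℝ}

theorem tendsto_rpow_zero_iff {α : Type*} {l : Filter α} {f : α → ℝ} (hf : ∀ i, 0 ≤ f i)
    (hr : 0 < r) : Tendsto (fun i => f i ^ r) l (𝓝 0) ↔ Tendsto f l (𝓝 0) := by
  constructor
  · intro h
    have h1 := h.rpow_const (p := 1 / r) (Or.inr (by positivity))
    rw [Real.zero_rpow (by positivity)] at h1
    refine h1.congr fun i => ?_
    rw [← Real.rpow_mul (hf i), mul_one_div_cancel hr.ne', Real.rpow_one]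
  · intro h
    have h1 := h.rpow_const (p := r) (Or.inr hr.le)
    rwa [Real.zero_rpow hr.ne'] at h1

theorem seriesHasLimit_iff (hr : 0 < r)
    (hsub : ∀ u v, q.toFun (u + v) ^ r ≤ q.toFun u ^ r + q.toFun v ^ r) {x : ℕ → X} {a : ℕ → 𝕜}
    {v : X} : SeriesHasLimit q x a v ↔
      letI := q.normedAddCommGroup hr hsub
      HasExpansion x a v := by
  let _ := q.normedAddCommGroup hr hsub
  have h : ∀ u : X, ‖u‖ = q.toFun u ^ r := fun u => rfl
  unfold SeriesHasLimit HasExpansion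
  rw [tendsto_iff_norm_sub_tendsto_zero (b := v), ← tendsto_rpow_zero_iff (fun _ => q.nonneg _) hr]
  exact tendsto_congr fun n => norm_sub_rev v _

theorem completeSpace_normedAddCommGroup (hr : 0 < r)
    (hsub : ∀ u v, q.toFun (u + v) ^ r ≤ q.toFun u ^ r + q.toFun v ^ r) (hq : q.IsComplete) :
    letI := q.normedAddCommGroup hr hsub
    CompleteSpace X := by
  let _ := q.normedAddCommGroup hr hsub
  have h : ∀ u : X, ‖u‖ = q.toFun u ^ r := fun u => rfl
  refine Metric.complete_of_cauchySeq_tendsto fun u hu => ?_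
  obtain ⟨v, hv⟩ := hq u fun ε hε => by
    obtain ⟨N, hN⟩ := Metric.cauchySeq_iff.1 hu (ε ^ r) (by positivity)
    refine ⟨N, fun m hm n hn => ?_⟩
    have h1 := hN m hm n hn
    rw [dist_eq_norm, h] at h1
    exact (Real.rpow_lt_rpow_iff (q.nonneg _) hε.le hr).1 h1
  refine ⟨v, ?_⟩
  rw [tendsto_iff_norm_sub_tendsto_zero]
  simp only [norm_sub_rev _ v]
  exact (tendsto_rpow_zero_iff (fun _ => q.nonneg _) hr).2 hv

theorem IsBasicSeq.isNormedBasic (hr : 0 < r)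
    (hsub : ∀ u v, q.toFun (u + v) ^ r ≤ q.toFun u ^ r + q.toFun v ^ r) {x : ℕ → X}
    (hx : IsBasicSeq q x) :
    letI := q.normedAddCommGroup hr hsub
    IsNormedBasic 𝕜 x := by
  let _ := q.normedAddCommGroup hr hsub
  have h : ∀ u : X, ‖u‖ = q.toFun u ^ r := fun u => rfl
  intro v hv
  have hv' : v ∈ closedLinearSpan q x := fun ε hε => by
    obtain ⟨u, hu, hd⟩ := Metric.mem_closure_iff.1 hv (ε ^ r) (by positivity)
    rw [dist_eq_norm, h] at hd
    exact ⟨u, hu, (Real.rpow_lt_rpow_iff (q.nonneg _) hε.le hr).1 hd⟩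
  obtain ⟨a, ha, huniq⟩ := hx v hv'
  exact ⟨a, (seriesHasLimit_iff hr hsub).1 ha,
    fun b hb => huniq b ((seriesHasLimit_iff hr hsub).2 hb)⟩

theorem VecQuasiNorm.rpow_smul (q : VecQuasiNorm 𝕜 X) (r : ℝ) (c : 𝕜) (v : X) :
    q.toFun (c • v) ^ r = ‖c‖ ^ r * q.toFun v ^ r := by
  rw [q.smul_eq, Real.mul_rpow (norm_nonneg _) (q.nonneg _)]

theorem IsUnconditionalBasicSeq.seriesConverges_comp_perm (hr : 0 < r)
    (hsub : ∀ u v, q.toFun (u + v) ^ r ≤ q.toFun u ^ r + q.toFun v ^ r) (hq : q.IsComplete)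
    {x : ℕ → X} (hx : IsUnconditionalBasicSeq q x) {a : ℕ → 𝕜} (ha : SeriesConverges q x a)
    (π : Equiv.Perm ℕ) : SeriesConverges q (fun j => x (π j)) (fun j => a (π j)) := by
  let _ := q.normedAddCommGroup hr hsub
  have : CompleteSpace X := completeSpace_normedAddCommGroup hr hsub hq
  obtain ⟨v, hv⟩ := ha
  refine ⟨v, (seriesHasLimit_iff hr hsub).2 ?_⟩
  exact HasExpansion.comp_perm hr (q.rpow_smul r) ((hx 1).isNormedBasic hr hsub) π
    ((hx π).isNormedBasic hr hsub) ((seriesHasLimit_iff hr hsub).1 hv)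

theorem IsBasicSeq.ne_zero (hr : 0 < r)
    (hsub : ∀ u v, q.toFun (u + v) ^ r ≤ q.toFun u ^ r + q.toFun v ^ r) {x : ℕ → X}
    (hx : IsBasicSeq q x) (i : ℕ) : x i ≠ 0 := by
  let _ := q.normedAddCommGroup hr hsub
  exact (hx.isNormedBasic hr hsub).ne_zero i

theorem seriesConverges_of_summable (hr : 0 < r)
    (hsub : ∀ u v, q.toFun (u + v) ^ r ≤ q.toFun u ^ r + q.toFun v ^ r) (hq : q.IsComplete)
    {x : ℕ → X} {a : ℕ → 𝕜} (h : Summable fun j => q.toFun (a j • x j) ^ r) :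
    SeriesConverges q x a := by
  let _ := q.normedAddCommGroup hr hsub
  have : CompleteSpace X := completeSpace_normedAddCommGroup hr hsub hq
  have h1 : Summable fun j => a j • x j := Summable.of_norm h
  exact ⟨_, (seriesHasLimit_iff hr hsub).2 h1.hasSum.tendsto_sum_nat⟩

theorem SeriesConverges.add_seq (hr : 0 < r)
    (hsub : ∀ u v, q.toFun (u + v) ^ r ≤ q.toFun u ^ r + q.toFun v ^ r)
    {x y z : ℕ → X} {a : ℕ → 𝕜} (hx : SeriesConverges q x a) (hy : SeriesConverges q y a)
    (hz : ∀ j, z j = x j + y j) : SeriesConverges q z a := by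
  obtain rfl : z = fun j => x j + y j := funext hz
  let _ := q.normedAddCommGroup hr hsub
  obtain ⟨u, hu⟩ := hx
  obtain ⟨v, hv⟩ := hy
  refine ⟨u + v, (seriesHasLimit_iff hr hsub).2 ?_⟩
  exact ((seriesHasLimit_iff hr hsub).1 hu).add_seq ((seriesHasLimit_iff hr hsub).1 hv)

theorem SeriesConverges.neg_seq (hr : 0 < r)
    (hsub : ∀ u v, q.toFun (u + v) ^ r ≤ q.toFun u ^ r + q.toFun v ^ r)
    {x : ℕ → X} {a : ℕ → 𝕜} (hx : SeriesConverges q x a) :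
    SeriesConverges q (fun j => -x j) a := by
  let _ := q.normedAddCommGroup hr hsub
  obtain ⟨u, hu⟩ := hx
  refine ⟨-u, (seriesHasLimit_iff hr hsub).2 ?_⟩
  exact ((seriesHasLimit_iff hr hsub).1 hu).neg_seq

theorem SeriesConverges.tendsto_zero (hr : 0 < r)
    (hsub : ∀ u v, q.toFun (u + v) ^ r ≤ q.toFun u ^ r + q.toFun v ^ r)
    {x : ℕ → X} {a : ℕ → 𝕜} (hx : SeriesConverges q x a) :
    Tendsto (fun j => q.toFun (a j • x j)) atTop (𝓝 0) := by
  let _ := q.normedAddCommGroup hr hsub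
  obtain ⟨u, hu⟩ := hx
  have hu' := (seriesHasLimit_iff hr hsub).1 hu
  have h1 := ((hu'.comp (tendsto_add_atTop_nat 1)).sub hu').norm
  rw [sub_self, norm_zero] at h1
  rw [← tendsto_rpow_zero_iff (fun _ => q.nonneg _) hr]
  refine h1.congr fun j => ?_
  simp only [Function.comp_apply, Finset.sum_range_succ, add_sub_cancel_left]
  rfl

theorem SeriesConverges.bddAbove (hr : 0 < r)
    (hsub : ∀ u v, q.toFun (u + v) ^ r ≤ q.toFun u ^ r + q.toFun v ^ r)
    {x : ℕ → X} {a : ℕ → 𝕜} (hx : SeriesConverges q x a) :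
    ∃ C : ℝ, ∀ n, q.toFun (∑ j ∈ Finset.range n, a j • x j) ≤ C := by
  let _ := q.normedAddCommGroup hr hsub
  obtain ⟨u, hu⟩ := hx
  obtain ⟨C, hC⟩ := (Tendsto.norm ((seriesHasLimit_iff hr hsub).1 hu)).bddAbove_range
  refine ⟨C ^ (1 / r), fun n => ?_⟩
  have h1 : q.toFun (∑ j ∈ Finset.range n, a j • x j) ^ r ≤ C := hC ⟨n, rfl⟩
  have h2 := Real.rpow_le_rpow (Real.rpow_nonneg (q.nonneg _) r) h1
    (show 0 ≤ 1 / r by positivity)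
  rwa [← Real.rpow_mul (q.nonneg _), mul_one_div_cancel hr.ne', Real.rpow_one] at h2

/-- The image series converges in every order, and for scalars this is absolute convergence. -/
theorem IsUnconditionalBasicSeq.summable_norm_apply (hr : 0 < r)
    (hsub : ∀ u v, q.toFun (u + v) ^ r ≤ q.toFun u ^ r + q.toFun v ^ r) (hq : q.IsComplete)
    {x : ℕ → X} (hx : IsUnconditionalBasicSeq q x) {a : ℕ → 𝕜} (ha : SeriesConverges q x a)
    (f : X →ₗ[𝕜] 𝕜) (hf : ∀ v, ‖f v‖ ≤ q.toFun v) : Summable fun j => ‖a j * f (x j)‖ := by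
  refine Summable.norm (summable_of_forall_perm fun π => ?_)
  obtain ⟨v, hv⟩ := hx.seriesConverges_comp_perm hr hsub hq ha π
  refine ⟨f v, ?_⟩
  rw [tendsto_iff_norm_sub_tendsto_zero]
  refine squeeze_zero (fun _ => norm_nonneg _) (fun n => ?_) hv
  refine le_trans (le_of_eq ?_) (hf _)
  rw [norm_sub_rev, map_sub, map_sum]
  simp only [map_smul, smul_eq_mul]

theorem SeriesConverges.extend {x : ℕ → X} {φ : ℕ → ℕ} (hφ : StrictMono φ) {a : ℕ → 𝕜}
    (ha : SeriesConverges q (fun j => x (φ j)) a) :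
    SeriesConverges q x (Function.extend φ a 0) := by
  classical
  obtain ⟨v, hv⟩ := ha
  refine ⟨v, ?_⟩
  have hex : ∀ n, ∃ j, n ≤ φ j := fun n => ⟨n, hφ.id_le n⟩
  -- `c n` counts the `j` with `φ j < n`: the partial sum of length `n` of the extended series is
  -- the one of length `c n` of the original.
  set c : ℕ → ℕ := fun n => Nat.find (hex n)
  have hc : ∀ n j, j < c n ↔ φ j < n := by
    intro n j
    constructor
    · intro h
      exact not_le.1 (Nat.find_min (hex n) h)
    · intro h
      by_contra hcon
      have h1 := hφ.monotone (not_lt.1 hcon)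
      have h2 : n ≤ φ (c n) := Nat.find_spec (hex n)
      lia
  have hct : Tendsto c atTop atTop := by
    refine tendsto_atTop.2 fun b => ?_
    filter_upwards [eventually_gt_atTop (φ b)] with n hn
    exact ((hc n b).2 hn).le
  refine (Tendsto.comp hv hct).congr fun n => ?_
  simp only [Function.comp_apply]
  congr 2
  calc ∑ j ∈ Finset.range (c n), a j • x (φ j)
      = ∑ j ∈ Finset.range (c n), Function.extend φ a 0 (φ j) • x (φ j) := by
        simp only [hφ.injective.extend_apply]
    _ = ∑ i ∈ (Finset.range (c n)).image φ, Function.extend φ a 0 i • x i :=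
        (Finset.sum_image (f := fun i => Function.extend φ a 0 i • x i) hφ.injective.injOn).symm
    _ = ∑ i ∈ Finset.range n, Function.extend φ a 0 i • x i := by
        refine Finset.sum_subset (fun i hi => ?_) fun i hi hi' => ?_
        · obtain ⟨j, hj, rfl⟩ := Finset.mem_image.1 hi
          exact Finset.mem_range.2 ((hc n j).1 (Finset.mem_range.1 hj))
        · rw [Function.extend_apply', Pi.zero_apply, zero_smul]
          rintro ⟨j, rfl⟩
          exact hi' (Finset.mem_image_of_mem _
            (Finset.mem_range.2 ((hc n j).2 (Finset.mem_range.1 hi))))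

end QuasiNormSeries

/-! ### The Lorentz quasi-norm as a weighted supremum -/

/-- Greedy choice of distinct representatives: the `k` elements already chosen cannot exhaust `T k`.
-/
theorem exists_injOn_mem {T : ℕ → Set ℕ} (hT : ∀ k : ℕ, (k : ℕ∞) < (T k).encard) (n : ℕ) :
    ∃ s : ℕ → ℕ, Set.InjOn s (Set.Iio n) ∧ ∀ k < n, s k ∈ T k := by
  induction n with
  | zero => exact ⟨id, by simp [Set.InjOn], by simp⟩
  | succ n ih =>
    obtain ⟨s, hs, hsT⟩ := ih
    have h1 : ¬ T n ⊆ s '' Set.Iio n := fun h => by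
      have h2 := (Set.encard_le_encard h).trans (Set.encard_image_le s _)
      rw [← Finset.coe_range, Set.encard_coe_eq_coe_finsetCard, Finset.card_range] at h2
      exact absurd (hT n) (not_lt.2 h2)
    obtain ⟨j, hj, hjs⟩ := Set.not_subset.1 h1
    refine ⟨Function.update s n j, ?_, fun k hk => ?_⟩
    · intro k hk l hl hkl
      simp only [Set.mem_Iio] at hk hl
      rcases eq_or_ne k n with rfl | hkn <;> rcases eq_or_ne l k with rfl | hln
      · rfl
      · rw [Function.update_self, Function.update_of_ne hln] at hkl
        exact absurd ⟨l, by simp only [Set.mem_Iio]; lia, hkl.symm⟩ hjs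
      · rfl
      · rcases eq_or_ne l n with rfl | hl'
        · rw [Function.update_self, Function.update_of_ne hkn] at hkl
          exact absurd ⟨k, by simp only [Set.mem_Iio]; lia, hkl⟩ hjs
        · rw [Function.update_of_ne hkn, Function.update_of_ne hl'] at hkl
          exact hs (by simp only [Set.mem_Iio]; lia) (by simp only [Set.mem_Iio]; lia) hkl
    · rcases eq_or_ne k n with rfl | hkn
      · rwa [Function.update_self]
      · rw [Function.update_of_ne hkn]
        exact hsT k (by lia)

theorem squeeze_zero_of_forall_eventually_le {α : Type*} {l : Filter α} {f : α → ℝ}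
    (hf : ∀ i, 0 ≤ f i) (h : ∀ ε : ℝ, 0 < ε → ∀ᶠ i in l, f i ≤ ε) : Tendsto f l (𝓝 0) := by
  refine tendsto_order.2 ⟨fun b hb => Eventually.of_forall fun i => hb.trans_le (hf i),
    fun ε hε => ?_⟩
  filter_upwards [h (ε / 2) (half_pos hε)] with n hn
  exact hn.trans_lt (half_lt_self hε)

section LorentzSum

variable {𝕜 : Type*} [RCLike 𝕜] {w : ℕ → ℝ} {p : ℝ}

/-- The weight with values in `ℝ≥0∞`. -/
noncomputable def eweight (w : ℕ → ℝ) (k : ℕ) : ℝ≥0∞ := ENNReal.ofReal (w k)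

theorem eweight_antitone (hw : w ∈ lorentzWeights) : Antitone (eweight w) := fun _ _ h =>
  ENNReal.ofReal_le_ofReal (hw.2.1 h)

theorem eweight_zero (hw : w ∈ lorentzWeights) : eweight w 0 = 1 := by
  rw [eweight, hw.1, ENNReal.ofReal_one]

theorem eweight_le_one (hw : w ∈ lorentzWeights) (k : ℕ) : eweight w k ≤ 1 :=
  eweight_zero hw ▸ eweight_antitone hw (Nat.zero_le k)

theorem eweight_ne_top (w : ℕ → ℝ) (k : ℕ) : eweight w k ≠ ∞ := ENNReal.ofReal_ne_top

theorem tendsto_eweight (hw : w ∈ lorentzWeights) : Tendsto (eweight w) atTop (𝓝 0) := by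
  have := ENNReal.tendsto_ofReal hw.2.2.2.1
  rwa [ENNReal.ofReal_zero] at this

theorem tsum_eweight (hw : w ∈ lorentzWeights) : ∑' k, eweight w k = ∞ := by
  by_contra h
  refine hw.2.2.2.2 ?_
  have h1 := ENNReal.summable_toReal h
  refine h1.congr fun k => ?_
  rw [eweight, ENNReal.toReal_ofReal (hw.2.2.1 k).le]

/-- For `≤`, any `t k` below the `k`-th rearranged term is attained or exceeded at more than `k`
indices, so distinct indices can be chosen, and `t` then increases to the rearrangement. For `≥`,
the smallest of `n` entries is at most the rearranged term of index `n - 1`, and Abel summation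
applies. -/
theorem lorentzSum_eq_wsup (hw : w ∈ lorentzWeights) (hp : 0 < p) (a : ℕ → 𝕜) :
    lorentzSum w p a = wsup (eweight w) fun i => ‖a i‖ₑ ^ p := by
  refine le_antisymm ?_ ?_
  · have key : ∀ (t : ℕ → ℝ≥0∞), (∀ k, t k < decRearr a k ∨ t k = 0) → ∀ n,
        ∑ k ∈ Finset.range n, eweight w k * t k ^ p ≤ wsup (eweight w) fun i => ‖a i‖ₑ ^ p := by
      intro t ht n
      obtain ⟨s, hs, hsT⟩ := exists_injOn_mem (T := fun k => {i | t k ≤ ‖a i‖ₑ}) (fun k : ℕ => by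
        rcases ht k with h | h
        · by_contra hcon
          have h1 : decRearr a k ≤ t k := sInf_le
            ((Set.encard_le_encard fun i hi => (Set.mem_ofPred.1 hi).le).trans (not_lt.1 hcon))
          exact absurd h (not_lt.2 h1)
        · simp [h]) n
      calc ∑ k ∈ Finset.range n, eweight w k * t k ^ p
          = ∑ k ∈ Finset.range n, eweight w k * (if k < n then t k ^ p else 0) :=
            Finset.sum_congr rfl fun k hk => by rw [if_pos (Finset.mem_range.1 hk)]
        _ ≤ wsup (eweight w) fun k => if k < n then t k ^ p else 0 :=
            sum_le_wsup _ _ _ id Function.injective_id.injOn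
        _ ≤ _ := by
            refine wsup_le_wsup_of_injOn s (hs.mono fun k hk => ?_) fun k hk => ?_
            · by_contra hcon
              exact hk (if_neg hcon)
            · have hkn : k < n := by
                by_contra hcon
                exact hk (if_neg hcon)
              rw [if_pos hkn]
              exact ENNReal.rpow_le_rpow (hsT k hkn) hp.le
    have hT : ∀ k, ∃ T : ℕ → ℝ≥0∞, (∀ m, T m < decRearr a k ∨ T m = 0) ∧
        Tendsto T atTop (𝓝 (decRearr a k)) := by
      intro k
      rcases eq_or_ne (decRearr a k) 0 with h | h
      · exact ⟨fun _ => 0, fun _ => Or.inr rfl, h ▸ tendsto_const_nhds⟩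
      · obtain ⟨u, -, hu, hut⟩ := exists_seq_strictMono_tendsto' (pos_iff_ne_zero.2 h)
        exact ⟨u, fun m => Or.inl (hu m).2, hut⟩
    choose T hT1 hT2 using hT
    unfold lorentzSum
    rw [ENNReal.tsum_eq_iSup_nat]
    refine iSup_le fun n => ?_
    have h1 : Tendsto (fun m => ∑ k ∈ Finset.range n, eweight w k * T k m ^ p) atTop
        (𝓝 (∑ k ∈ Finset.range n, eweight w k * decRearr a k ^ p)) :=
      tendsto_finsetSum _ fun k _ => ENNReal.Tendsto.const_mul
        ((ENNReal.continuous_rpow_const.tendsto _).comp (hT2 k)) (Or.inr (eweight_ne_top w k))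
    exact le_of_tendsto' h1 fun m => key (fun k => T k m) (fun k => hT1 k m) n
  · refine wsup_le_tsum (eweight_antitone hw) (tendsto_eweight hw) fun A hA => ?_
    obtain ⟨i, hi, hmin⟩ := A.exists_min_image (fun i => ‖a i‖ₑ) hA
    refine ⟨i, hi, ENNReal.rpow_le_rpow (le_sInf fun t ht => ?_) hp.le⟩
    by_contra hcon
    have h1 : (A : Set ℕ) ⊆ {j | t < ‖a j‖ₑ} := fun j hj =>
      lt_of_lt_of_le (not_le.1 hcon) (hmin j hj)
    have h2 := (Set.encard_le_encard h1).trans ht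
    rw [Set.encard_coe_eq_coe_finsetCard] at h2
    have h3 : A.card ≤ A.card - 1 := by exact_mod_cast h2
    have := Finset.card_pos.2 hA
    lia

theorem lorentzENorm_rpow (hp : 0 < p) (a : ℕ → 𝕜) :
    lorentzENorm w p a ^ p = lorentzSum w p a := by
  rw [lorentzENorm, ← ENNReal.rpow_mul, one_div_mul_cancel hp.ne', ENNReal.rpow_one]

/-- Subadditivity with constant `1`, unlike the defining quasi-norm inequality: a supremum of
weighted `ℓ_p` norms when `p ≥ 1`, and of sums of subadditive `p`-th powers when `p ≤ 1`. This
produces a genuine translation-invariant metric. -/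
theorem lorentzENorm_add_rpow_le (hw : w ∈ lorentzWeights) (hp : 0 < p) (a b : ℕ → 𝕜) :
    lorentzENorm w p (a + b) ^ min 1 p ≤
      lorentzENorm w p a ^ min 1 p + lorentzENorm w p b ^ min 1 p := by
  rcases le_total p 1 with h | h
  · rw [min_eq_right h]
    simp only [lorentzENorm_rpow hp, lorentzSum_eq_wsup hw hp]
    refine (wsup_mono fun i => ?_).trans (wsup_add_le _ _)
    exact (ENNReal.rpow_le_rpow (enorm_add_le (a i) (b i)) hp.le).trans
      (ENNReal.rpow_add_le_add_rpow _ _ hp.le h)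
  · rw [min_eq_left h]
    simp only [ENNReal.rpow_one, lorentzENorm, lorentzSum_eq_wsup hw hp]
    rw [← ENNReal.rpow_le_rpow_iff hp, ← ENNReal.rpow_mul, one_div_mul_cancel hp.ne',
      ENNReal.rpow_one]
    refine wsup_le fun A τ hτ => ?_
    have h1 : ∀ (c : 𝕜) (i : ℕ), (eweight w (τ i) ^ (1 / p) * ‖c‖ₑ) ^ p =
        eweight w (τ i) * ‖c‖ₑ ^ p := fun c i => by
      rw [ENNReal.mul_rpow_of_nonneg _ _ hp.le, ← ENNReal.rpow_mul, one_div_mul_cancel hp.ne',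
        ENNReal.rpow_one]
    have h2 := ENNReal.Lp_add_le A (fun i => eweight w (τ i) ^ (1 / p) * ‖a i‖ₑ)
      (fun i => eweight w (τ i) ^ (1 / p) * ‖b i‖ₑ) h
    simp only [h1] at h2
    have h3 : ∑ i ∈ A, eweight w (τ i) * ‖(a + b) i‖ₑ ^ p ≤
        ∑ i ∈ A, (eweight w (τ i) ^ (1 / p) * ‖a i‖ₑ + eweight w (τ i) ^ (1 / p) * ‖b i‖ₑ) ^ p := by
      refine Finset.sum_le_sum fun i _ => ?_
      rw [← h1, ← mul_add]
      exact ENNReal.rpow_le_rpow (mul_le_mul_right (enorm_add_le (a i) (b i)) _) hp.le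
    calc _ ≤ _ := h3
      _ = ((∑ i ∈ A, (eweight w (τ i) ^ (1 / p) * ‖a i‖ₑ +
            eweight w (τ i) ^ (1 / p) * ‖b i‖ₑ) ^ p) ^ (1 / p)) ^ p := by
          rw [← ENNReal.rpow_mul, one_div_mul_cancel hp.ne', ENNReal.rpow_one]
      _ ≤ _ := by
          refine ENNReal.rpow_le_rpow (h2.trans (add_le_add ?_ ?_)) hp.le <;>
          exact ENNReal.rpow_le_rpow
            (sum_le_wsup (eweight w) (fun i => ‖_‖ₑ ^ p) A τ hτ) (by positivity)

theorem tendsto_zero_of_wsup_ne_top (hw : w ∈ lorentzWeights) (hp : 0 < p) {a : ℕ → 𝕜}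
    (ha : wsup (eweight w) (fun i => ‖a i‖ₑ ^ p) ≠ ∞) : Tendsto a atTop (𝓝 0) := by
  rw [tendsto_zero_iff_norm_tendsto_zero, ← Nat.cofinite_eq_atTop]
  refine tendsto_order.2 ⟨fun b hb => Eventually.of_forall fun i => hb.trans_le (norm_nonneg _),
    fun ε hε => ?_⟩
  have h1 := finite_le_of_wsup_ne_top (tsum_eweight hw) ha
    (η := ENNReal.ofReal ε ^ p) (by simp [ENNReal.rpow_eq_zero_iff, hε, hp.not_gt])
  refine (h1.eventually_cofinite_notMem).mono fun i hi => ?_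
  by_contra hcon
  refine hi (ENNReal.rpow_le_rpow ?_ hp.le)
  rw [← ofReal_norm]
  exact ENNReal.ofReal_le_ofReal (not_lt.1 hcon)

theorem mem_lorentzSpace (hw : w ∈ lorentzWeights) (hp : 0 < p) {a : ℕ → 𝕜} :
    a ∈ lorentzSpace 𝕜 w hw p hp ↔ wsup (eweight w) (fun i => ‖a i‖ₑ ^ p) ≠ ∞ := by
  rw [← lorentzSum_eq_wsup hw hp]
  constructor
  · rintro ⟨-, h⟩ hcon
    rw [lorentzENorm, hcon, ENNReal.top_rpow_of_pos (by positivity)] at h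
    exact lt_irrefl _ h
  · intro h
    refine ⟨tendsto_zero_of_wsup_ne_top hw hp (by rwa [← lorentzSum_eq_wsup hw hp]), ?_⟩
    exact (ENNReal.rpow_ne_top_of_nonneg (by positivity) h).lt_top

theorem lorentzQuasiNorm_eq (hw : w ∈ lorentzWeights) (hp : 0 < p)
    (a : lorentzSpace 𝕜 w hw p hp) : (lorentzQuasiNorm 𝕜 w hw p hp).toFun a =
      (wsup (eweight w) (fun i => ‖(a : ℕ → 𝕜) i‖ₑ ^ p) ^ (1 / p)).toReal := by
  rw [← lorentzSum_eq_wsup hw hp]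
  rfl

theorem lorentzQuasiNorm_le_iff (hw : w ∈ lorentzWeights) (hp : 0 < p)
    (a : lorentzSpace 𝕜 w hw p hp) {C : ℝ} (hC : 0 ≤ C) :
    (lorentzQuasiNorm 𝕜 w hw p hp).toFun a ≤ C ↔
      wsup (eweight w) (fun i => ‖(a : ℕ → 𝕜) i‖ₑ ^ p) ≤ ENNReal.ofReal (C ^ p) := by
  rw [lorentzQuasiNorm_eq]
  have h1 := (mem_lorentzSpace hw hp).1 a.2
  have h2 : wsup (eweight w) (fun i => ‖(a : ℕ → 𝕜) i‖ₑ ^ p) ^ (1 / p) ≠ ∞ :=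
    ENNReal.rpow_ne_top_of_nonneg (by positivity) h1
  rw [← ENNReal.ofReal_rpow_of_nonneg hC hp.le, ← ENNReal.le_ofReal_iff_toReal_le h2 hC, one_div,
    ENNReal.rpow_inv_le_iff hp]

theorem lorentzQuasiNorm_add_rpow_le (hw : w ∈ lorentzWeights) (hp : 0 < p)
    (a b : lorentzSpace 𝕜 w hw p hp) :
    (lorentzQuasiNorm 𝕜 w hw p hp).toFun (a + b) ^ min 1 p ≤
      (lorentzQuasiNorm 𝕜 w hw p hp).toFun a ^ min 1 p +
        (lorentzQuasiNorm 𝕜 w hw p hp).toFun b ^ min 1 p := by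
  have hr : 0 ≤ min 1 p := le_min zero_le_one hp.le
  have ha := ENNReal.rpow_ne_top_of_nonneg hr a.2.2.ne
  have hb := ENNReal.rpow_ne_top_of_nonneg hr b.2.2.ne
  have h := ENNReal.toReal_mono (ENNReal.add_ne_top.2 ⟨ha, hb⟩)
    (lorentzENorm_add_rpow_le hw hp (a : ℕ → 𝕜) b)
  rw [ENNReal.toReal_add ha hb] at h
  simp only [← ENNReal.toReal_rpow] at h
  exact h

theorem norm_apply_le_lorentzQuasiNorm (hw : w ∈ lorentzWeights) (hp : 0 < p)
    (a : lorentzSpace 𝕜 w hw p hp) (i : ℕ) :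
    ‖(a : ℕ → 𝕜) i‖ ≤ (lorentzQuasiNorm 𝕜 w hw p hp).toFun a := by
  have h1 := (lorentzQuasiNorm_le_iff hw hp a ((lorentzQuasiNorm 𝕜 w hw p hp).nonneg a)).1 le_rfl
  have h2 := (mul_le_wsup (eweight w) (fun i => ‖(a : ℕ → 𝕜) i‖ₑ ^ p) i).trans h1
  rw [eweight_zero hw, one_mul, ← ENNReal.ofReal_rpow_of_nonneg
    ((lorentzQuasiNorm 𝕜 w hw p hp).nonneg a) hp.le, ENNReal.rpow_le_rpow_iff hp, ← ofReal_norm,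
    ENNReal.ofReal_le_ofReal_iff ((lorentzQuasiNorm 𝕜 w hw p hp).nonneg a)] at h2
  exact h2

theorem wsup_sub_le_of_tendsto (hw : w ∈ lorentzWeights) (hp : 0 < p)
    {u : ℕ → lorentzSpace 𝕜 w hw p hp} {v : ℕ → 𝕜}
    (hv : ∀ i, Tendsto (fun n => (u n : ℕ → 𝕜) i) atTop (𝓝 (v i))) (b : lorentzSpace 𝕜 w hw p hp)
    {C : ℝ} (hC : 0 ≤ C)
    (h : ∀ᶠ n in atTop, (lorentzQuasiNorm 𝕜 w hw p hp).toFun (u n - b) ≤ C) :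
    wsup (eweight w) (fun i => ‖v i - (b : ℕ → 𝕜) i‖ₑ ^ p) ≤ ENNReal.ofReal (C ^ p) := by
  refine wsup_le_of_tendsto (eweight_ne_top w)
    (g := fun m i => ‖(u m : ℕ → 𝕜) i - (b : ℕ → 𝕜) i‖ₑ ^ p) (fun i => ?_) ?_
  · exact (ENNReal.continuous_rpow_const.tendsto _).comp ((hv i).sub_const _).enorm
  · filter_upwards [h] with m hm
    exact (lorentzQuasiNorm_le_iff hw hp (u m - b) hC).1 hm

/-- Coordinatewise limits exist, and lower semicontinuity of `wsup` makes them limits in quasi-norm.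
-/
theorem lorentzQuasiNorm_isComplete (hw : w ∈ lorentzWeights) (hp : 0 < p) :
    (lorentzQuasiNorm 𝕜 w hw p hp).IsComplete := by
  intro u hu
  have hlim : ∀ i, ∃ c : 𝕜, Tendsto (fun n => (u n : ℕ → 𝕜) i) atTop (𝓝 c) := by
    intro i
    refine cauchySeq_tendsto_of_complete (Metric.cauchySeq_iff.2 fun ε hε => ?_)
    obtain ⟨N, hN⟩ := hu ε hε
    refine ⟨N, fun m hm n hn => ?_⟩
    rw [dist_eq_norm]
    exact (norm_apply_le_lorentzQuasiNorm hw hp (u m - u n) i).trans_lt (hN m hm n hn)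
  choose v hv using hlim
  have hle : ∀ ε : ℝ, 0 < ε → ∃ N, ∀ n ≥ N,
      wsup (eweight w) (fun i => ‖v i - (u n : ℕ → 𝕜) i‖ₑ ^ p) ≤ ENNReal.ofReal (ε ^ p) := by
    intro ε hε
    obtain ⟨N, hN⟩ := hu ε hε
    refine ⟨N, fun n hn => wsup_sub_le_of_tendsto hw hp hv (u n) hε.le ?_⟩
    filter_upwards [eventually_ge_atTop N] with m hm
    exact (hN m hm n hn).le
  have hvmem : v ∈ lorentzSpace 𝕜 w hw p hp := by
    obtain ⟨N, hN⟩ := hle 1 one_pos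
    have h1 : (fun i => v i - (u N : ℕ → 𝕜) i) ∈ lorentzSpace 𝕜 w hw p hp :=
      (mem_lorentzSpace hw hp).2 (ne_top_of_le_ne_top ENNReal.ofReal_ne_top (hN N le_rfl))
    have h2 := Submodule.add_mem _ h1 (u N).2
    have h3 : (fun i => v i - (u N : ℕ → 𝕜) i) + (u N : ℕ → 𝕜) = v := funext fun i => by simp
    rwa [h3] at h2
  obtain ⟨V, rfl⟩ : ∃ V : lorentzSpace 𝕜 w hw p hp, (V : ℕ → 𝕜) = v := ⟨⟨v, hvmem⟩, rfl⟩
  refine ⟨V, squeeze_zero_of_forall_eventually_le (fun n => VecQuasiNorm.nonneg _ _)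
    fun ε hε => ?_⟩
  obtain ⟨N, hN⟩ := hle ε hε
  filter_upwards [eventually_ge_atTop N] with n hn
  rw [lorentzQuasiNorm_le_iff hw hp _ hε.le]
  exact hN n hn

end LorentzSum

/-! ### Families of decreasing sequences -/

section Families

variable {W : ℕ → ℝ≥0∞}

theorem tsum_two_inv_pow_ne_top : ∑' j : ℕ, ((2 : ℝ≥0∞)⁻¹) ^ j ≠ ∞ := by
  rw [ENNReal.tsum_geometric, ENNReal.one_sub_inv_two, inv_inv]
  exact ENNReal.ofNat_ne_top

theorem two_inv_pow_ne_zero (j : ℕ) : ((2 : ℝ≥0∞)⁻¹) ^ j ≠ 0 :=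
  pow_ne_zero _ (ENNReal.inv_ne_zero.2 ENNReal.ofNat_ne_top)

theorem two_inv_pow_antitone : Antitone fun j : ℕ => ((2 : ℝ≥0∞)⁻¹) ^ j := fun _ _ h =>
  pow_le_pow_of_le_one zero_le (ENNReal.inv_le_one.2 one_le_two) h

theorem wsup_prod_ne_top {c : ℕ → ℝ≥0∞} {M : ℝ≥0∞} (hM : M ≠ ∞) (hc : ∀ j, c j ≤ M)
    {D : ℕ → ℕ → ℝ≥0∞} (hD : ∑' j, wsup W (D j) ≠ ∞) :
    wsup W (fun x : ℕ × ℕ => c x.1 * D x.1 x.2) ≠ ∞ := by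
  refine ne_top_of_le_ne_top (ENNReal.mul_ne_top hM hD) ((wsup_prod_le c D).trans ?_)
  rw [← ENNReal.tsum_mul_left]
  exact ENNReal.tsum_le_tsum fun j => mul_le_mul_left (hc j) _

/-- Splitting a family of sequences that are close to `v` on initial segments. -/
theorem wsup_prod_ne_top_iff (hW1 : ∀ k, W k ≤ 1) {g : ℕ → ℕ → ℝ≥0∞} {v : ℕ → ℝ≥0∞} {n : ℕ → ℕ}
    {c : ℕ → ℝ≥0∞} {M : ℝ≥0∞} (hM : M ≠ ∞) (hc : ∀ j, c j ≤ M)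
    (hv : ∑' j, wsup W (fun k => if n j ≤ k then v k else 0) ≠ ∞)
    (hd : ∑' j, ∑ k ∈ Finset.range (n j), ((g j k - v k) + (v k - g j k)) ≠ ∞) :
    wsup W (fun x : ℕ × ℕ => c x.1 * g x.1 x.2) ≠ ∞ ↔
      wsup W (fun x : ℕ × ℕ => c x.1 * v x.2) ≠ ∞ ∧
        wsup W (fun x : ℕ × ℕ => c x.1 * g x.1 (n x.1 + x.2)) ≠ ∞ := by
  -- With truncated subtraction the two differences add up to `|g j k - v k|`. `D` is the error on
  -- the heads and `T` the neglected tail of `v`; both contribute finitely.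
  set D : ℕ → ℕ → ℝ≥0∞ := fun j k => if k < n j then (g j k - v k) + (v k - g j k) else 0
  set T : ℕ → ℕ → ℝ≥0∞ := fun j k => if n j ≤ k then v k else 0
  have hD : wsup W (fun x : ℕ × ℕ => c x.1 * D x.1 x.2) ≠ ∞ := by
    refine wsup_prod_ne_top hM hc (ne_top_of_le_ne_top hd (ENNReal.tsum_le_tsum fun j => ?_))
    refine (wsup_le_finset_sum hW1 (D j) (Finset.range (n j)) fun k hk => ?_).trans
      (Finset.sum_le_sum fun k hk => ?_)
    · exact if_neg (by simpa using hk)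
    · simp only [D]
      rw [if_pos (Finset.mem_range.1 hk)]
  have hT : wsup W (fun x : ℕ × ℕ => c x.1 * T x.1 x.2) ≠ ∞ := wsup_prod_ne_top hM hc hv
  have htail : wsup W (fun x : ℕ × ℕ => c x.1 * (if n x.1 ≤ x.2 then g x.1 x.2 else 0)) ≤
      wsup W (fun x : ℕ × ℕ => c x.1 * g x.1 (n x.1 + x.2)) := by
    have hsup : ∀ x : ℕ × ℕ, c x.1 * (if n x.1 ≤ x.2 then g x.1 x.2 else 0) ≠ 0 → n x.1 ≤ x.2 := by
      intro x hx
      by_contra hcon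
      exact hx (by rw [if_neg hcon, mul_zero])
    refine wsup_le_wsup_of_injOn (fun x => (x.1, x.2 - n x.1)) ?_ fun x hx => ?_
    · rintro ⟨j, k⟩ hx ⟨j', k'⟩ hy hxy
      have h1 := hsup _ hx
      have h2 := hsup _ hy
      simp only [Prod.mk.injEq] at hxy h1 h2 ⊢
      obtain ⟨rfl, h3⟩ := hxy
      exact ⟨rfl, by lia⟩
    · have h1 := hsup x hx
      simp only [if_pos h1, Nat.add_sub_cancel' h1, le_refl]
  constructor
  · intro h
    refine ⟨?_, ?_⟩
    · refine ne_top_of_le_ne_top (ENNReal.add_ne_top.2 ⟨h, ENNReal.add_ne_top.2 ⟨hD, hT⟩⟩) ?_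
      refine le_trans ?_ ((wsup_add_le _ _).trans (add_le_add_right (wsup_add_le _ _) _))
      refine wsup_mono fun x => ?_
      rw [← mul_add, ← mul_add]
      refine mul_le_mul_right ?_ _
      by_cases hk : x.2 < n x.1
      · simp only [D, T, if_pos hk, if_neg (not_le.2 hk), add_zero]
        calc v x.2 ≤ g x.1 x.2 + (v x.2 - g x.1 x.2) := le_add_tsub
          _ ≤ _ := add_le_add_right le_add_self _
      · simp only [D, T, if_neg hk, if_pos (not_lt.1 hk), zero_add]
        exact le_add_self
    · refine ne_top_of_le_ne_top h ?_
      refine wsup_le_wsup_of_injOn (fun x => (x.1, n x.1 + x.2)) ?_ fun x _ => le_rfl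
      rintro ⟨j, k⟩ - ⟨j', k'⟩ - hxy
      simp only [Prod.mk.injEq] at hxy ⊢
      obtain ⟨rfl, h3⟩ := hxy
      exact ⟨rfl, by lia⟩
  · rintro ⟨h1, h2⟩
    refine ne_top_of_le_ne_top (ENNReal.add_ne_top.2 ⟨h1, ENNReal.add_ne_top.2
      ⟨hD, ne_top_of_le_ne_top h2 htail⟩⟩) ?_
    refine le_trans ?_ ((wsup_add_le _ _).trans (add_le_add_right (wsup_add_le _ _) _))
    refine wsup_mono fun x => ?_
    rw [← mul_add, ← mul_add]
    refine mul_le_mul_right ?_ _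
    by_cases hk : x.2 < n x.1
    · simp only [D, if_pos hk, if_neg (not_le.2 hk), add_zero]
      calc g x.1 x.2 ≤ v x.2 + (g x.1 x.2 - v x.2) := le_add_tsub
        _ ≤ _ := add_le_add_right le_self_add _
    · simp only [D, if_neg hk, if_pos (not_lt.1 hk), zero_add]
      exact le_add_self

/-- For a flat sequence, giving up the first `M` weights costs only `M * f 0`. -/
theorem tsum_mul_le_of_antitone (hW1 : ∀ k, W k ≤ 1) {f : ℕ → ℝ≥0∞} (hf : Antitone f) (M : ℕ) :
    ∑' k, W k * f k ≤ M * f 0 + ∑' k, W (M + k) * f k := by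
  rw [← Summable.sum_add_tsum_nat_add' (f := fun k => W k * f k) (k := M) ENNReal.summable]
  refine add_le_add ?_ (ENNReal.tsum_le_tsum fun k => ?_)
  · calc ∑ k ∈ Finset.range M, W k * f k ≤ ∑ k ∈ Finset.range M, f 0 :=
          Finset.sum_le_sum fun k _ => (mul_le_mul' (hW1 k) (hf (Nat.zero_le k))).trans (one_mul _).le
      _ = M * f 0 := by simp
  · rw [add_comm k M]
    exact mul_le_mul_right (hf (Nat.le_add_left k M)) _

/-- Normalized decreasing sequences whose sup norms tend to `0` have a subsequence satisfying a
lower `ℓ₁`-estimate. -/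
theorem exists_subseq_tsum_le_wsup (hW : Antitone W) (hW0 : Tendsto W atTop (𝓝 0))
    (hW1 : ∀ k, W k ≤ 1) {f : ℕ → ℕ → ℝ≥0∞} (hf : ∀ j, Antitone (f j))
    (hf0 : Tendsto (fun j => f j 0) atTop (𝓝 0)) {δ : ℝ≥0∞} (hδ : δ ≠ 0) (hδt : δ ≠ ∞)
    (hfδ : ∀ᶠ j in atTop, δ ≤ wsup W (f j)) :
    ∃ φ : ℕ → ℕ, StrictMono φ ∧ ∃ η : ℝ≥0∞, η ≠ 0 ∧ ∀ c : ℕ → ℝ≥0∞,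
      (∑' j, c j) * η ≤ wsup W (fun x : ℕ × ℕ => c x.1 * f (φ x.1) x.2) := by
  classical
  have hδ2 : δ / 2 ≠ 0 := by simpa using hδ
  have hδ2t : δ / 2 ≠ ∞ := ENNReal.div_ne_top hδt two_ne_zero
  set η : ℝ≥0∞ := δ / 2 / 2
  have hη : η ≠ 0 := by simpa [η] using hδ
  -- A triple `(j, M, N)` records that `f j` already collects `η` from its first `N` terms placed on
  -- the weights `M, …, M + N - 1`. Flatness provides such a `j` for every `M`, so the windows can
  -- be made disjoint.
  obtain ⟨s, hs, hsr⟩ := exists_seq_of_forall_finset_exists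
    (P := fun x : ℕ × ℕ × ℕ => η ≤ ∑ k ∈ Finset.range x.2.2, W (x.2.1 + k) * f x.1 k)
    (r := fun x y => x.1 < y.1 ∧ x.2.1 + x.2.2 ≤ y.2.1) (by
      intro S _
      set M := S.sup fun x => x.2.1 + x.2.2
      have hM : ∀ x ∈ S, x.2.1 + x.2.2 ≤ M := fun x hx =>
        Finset.le_sup (f := fun x : ℕ × ℕ × ℕ => x.2.1 + x.2.2) hx
      have h1 : Tendsto (fun j => (M : ℝ≥0∞) * f j 0) atTop (𝓝 0) := by
        simpa using ENNReal.Tendsto.const_mul hf0 (Or.inr (ENNReal.natCast_ne_top M))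
      have h2 := h1.eventually (eventually_le_nhds (pos_iff_ne_zero.2 hδ2))
      obtain ⟨j, ⟨hj1, hj2⟩, hj3⟩ := ((h2.and hfδ).and
        (eventually_gt_atTop (S.sup fun x => x.1))).exists
      have h3 : δ ≤ ∑' k, W k * f j k := hj2.trans (wsup_le_tsum_of_antitone hW hW0 (hf j))
      have h4 := tsum_mul_le_of_antitone hW1 (hf j) M
      have h5 : δ / 2 ≤ ∑' k, W (M + k) * f j k := by
        have h6 := h3.trans (h4.trans (add_le_add_left hj1 _))
        rw [← ENNReal.add_halves δ] at h6
        exact (ENNReal.add_le_add_iff_left (by simpa using hδ2t)).1 (by simpa using h6)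
      have h7 : η < ∑' k, W (M + k) * f j k :=
        (ENNReal.half_lt_self hδ2 hδ2t).trans_le h5
      rw [ENNReal.tsum_eq_iSup_nat, lt_iSup_iff] at h7
      obtain ⟨N, hN⟩ := h7
      refine ⟨(j, M, N), hN.le, fun x hx => ⟨?_, hM x hx⟩⟩
      exact lt_of_le_of_lt (Finset.le_sup (f := fun x : ℕ × ℕ × ℕ => x.1) hx) hj3)
  refine ⟨fun i => (s i).1, fun i j h => (hsr i j h).1, η, hη, fun c => ?_⟩
  rw [ENNReal.tsum_eq_iSup_nat, ENNReal.iSup_mul]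
  refine iSup_le fun I => ?_
  set K := (Finset.range I).sup fun i => (s i).2.2
  have hK : ∀ i ∈ Finset.range I, (s i).2.2 ≤ K := fun i hi =>
    Finset.le_sup (f := fun i => (s i).2.2) hi
  set A := (Finset.range I ×ˢ Finset.range K).filter fun x : ℕ × ℕ => x.2 < (s x.1).2.2
  set τ : ℕ × ℕ → ℕ := fun x => (s x.1).2.1 + x.2
  have hτ : Set.InjOn τ (A : Set (ℕ × ℕ)) := by
    rintro ⟨i, k⟩ hx ⟨j, l⟩ hy hxy
    have h1 : k < (s i).2.2 := (Finset.mem_filter.1 hx).2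
    have h2 : l < (s j).2.2 := (Finset.mem_filter.1 hy).2
    have h3 : (s i).2.1 + k = (s j).2.1 + l := hxy
    rcases lt_trichotomy i j with h | h | h
    · have := (hsr i j h).2
      lia
    · subst h
      rw [Prod.mk.injEq]
      exact ⟨rfl, by lia⟩
    · have := (hsr j i h).2
      lia
  refine le_trans ?_ (sum_le_wsup W _ A τ hτ)
  rw [Finset.sum_filter, Finset.sum_product, Finset.sum_mul]
  refine Finset.sum_le_sum fun i hi => ?_
  rw [← Finset.sum_filter]
  have h1 : (Finset.range K).filter (fun k => k < (s i).2.2) = Finset.range (s i).2.2 := by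
    ext k
    have := hK i hi
    simp only [Finset.mem_filter, Finset.mem_range]
    lia
  rw [h1]
  calc c i * η ≤ c i * ∑ k ∈ Finset.range (s i).2.2, W ((s i).2.1 + k) * f (s i).1 k :=
        mul_le_mul_right (hs i) _
    _ = _ := by
        rw [Finset.mul_sum]
        exact Finset.sum_congr rfl fun k _ => mul_left_comm _ _ _

/-- The first `n j + 1` terms of `g j` are at least `g j (n j)`, so that value times a divergent
partial sum of `W` stays below `B`. -/
theorem tendsto_zero_of_antitone_of_wsup_le (hWs : ∑' k, W k = ∞) {g : ℕ → ℕ → ℝ≥0∞}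
    (hg : ∀ j, Antitone (g j)) {B : ℝ≥0∞} (hB : B ≠ ∞) (hgB : ∀ j, wsup W (g j) ≤ B) {n : ℕ → ℕ}
    (hn : ∀ j, j ≤ n j) : Tendsto (fun j => g j (n j)) atTop (𝓝 0) := by
  have h1 : ∀ j, (∑ k ∈ Finset.range (n j + 1), W k) * g j (n j) ≤ B := fun j => by
    refine le_trans ?_ (hgB j)
    have h := sum_range_mul_le_wsup W (h := g j) (A := Finset.range (n j + 1)) (η := g j (n j))
      fun i hi => hg j (Nat.lt_succ_iff.1 (Finset.mem_range.1 hi))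
    rwa [Finset.card_range] at h
  have h2 : Tendsto (fun j => ∑ k ∈ Finset.range (n j + 1), W k) atTop (𝓝 ∞) :=
    hWs ▸ (ENNReal.tendsto_nat_tsum W).comp (tendsto_atTop_mono
      (fun j => (hn j).trans (Nat.le_succ _)) tendsto_id)
  refine ENNReal.tendsto_nhds_zero.2 fun ε hε => ?_
  have h3 : B / ε < ∞ := (ENNReal.div_ne_top hB hε.ne').lt_top
  filter_upwards [h2.eventually (lt_mem_nhds h3)] with j hj
  by_contra hcon
  have hε' : ε ≠ ∞ := (not_le.1 hcon).ne_top
  rw [ENNReal.div_lt_iff (Or.inl hε.ne') (Or.inl hε')] at hj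
  exact absurd ((mul_le_mul_right (not_le.1 hcon).le _).trans (h1 j)) (not_le.2 hj)

/-- A bounded family of decreasing sequences has a subsequence on which finiteness of the weighted
supremum is invariant under permutations of the coefficients. -/
theorem exists_subseq_wsup_symmetric (hW : Antitone W) (hW0 : Tendsto W atTop (𝓝 0))
    (hW1 : ∀ k, W k ≤ 1) (hW00 : W 0 = 1) (hWs : ∑' k, W k = ∞) {h : ℕ → ℕ → ℝ≥0∞}
    (hh : ∀ j, Antitone (h j)) {B : ℝ≥0∞} (hB : B ≠ ∞) (hhB : ∀ j, wsup W (h j) ≤ B) :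
    ∃ φ : ℕ → ℕ, StrictMono φ ∧ ∀ (c : ℕ → ℝ≥0∞) (M : ℝ≥0∞), M ≠ ∞ → (∀ j, c j ≤ M) →
      ∀ π : Equiv.Perm ℕ, wsup W (fun x : ℕ × ℕ => c x.1 * h (φ x.1) x.2) ≠ ∞ →
        wsup W (fun x : ℕ × ℕ => c (π x.1) * h (φ x.1) x.2) ≠ ∞ := by
  have hWt : ∀ k, W k ≠ ∞ := fun k => ne_top_of_le_ne_top ENNReal.one_ne_top (hW1 k)
  obtain ⟨v, φ₁, hφ₁, hlim⟩ := CompactSpace.tendsto_subseq h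
  rw [tendsto_pi_nhds] at hlim
  have hvB : wsup W v ≤ B :=
    wsup_le_of_tendsto hWt hlim (Eventually.of_forall fun j => hhB (φ₁ j))
  have hvt : ∀ k, v k ≠ ∞ := fun k => by
    have := mul_le_wsup W v k
    rw [hW00, one_mul] at this
    exact ne_top_of_le_ne_top hB (this.trans hvB)
  have hn : ∀ j : ℕ, ∃ n, j ≤ n ∧
      wsup W (fun k => if n ≤ k then v k else 0) ≤ ((2 : ℝ≥0∞)⁻¹) ^ j := by
    intro j
    obtain ⟨A, hA⟩ := exists_finset_wsup_le hWs hW1 (ne_top_of_le_ne_top hB hvB)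
      (two_inv_pow_ne_zero j)
    refine ⟨max j (A.sup id + 1), le_max_left _ _, hA _ (fun i hi => if_neg ?_) fun i => ?_⟩
    · have : i ≤ A.sup id := Finset.le_sup (f := id) hi
      have := le_max_right j (A.sup id + 1)
      lia
    · split_ifs
      · exact le_rfl
      · exact zero_le
  choose n hnj hnv using hn
  obtain ⟨φ₂, hφ₂, hd⟩ := extraction_forall_of_eventually' (P := fun j i =>
    ∑ k ∈ Finset.range (n j), ((h (φ₁ i) k - v k) + (v k - h (φ₁ i) k)) ≤ ((2 : ℝ≥0∞)⁻¹) ^ j) (by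
      intro j
      refine eventually_atTop.1 ?_
      have h1 : Tendsto (fun i => ∑ k ∈ Finset.range (n j),
          ((h (φ₁ i) k - v k) + (v k - h (φ₁ i) k))) atTop (𝓝 0) := by
        rw [← Finset.sum_const_zero (s := Finset.range (n j)) (ι := ℕ)]
        refine tendsto_finsetSum _ fun k _ => ?_
        have h2 := ENNReal.Tendsto.sub (hlim k) (tendsto_const_nhds (x := v k)) (Or.inl (hvt k))
        have h3 := ENNReal.Tendsto.sub (tendsto_const_nhds (x := v k)) (hlim k) (Or.inl (hvt k))
        simpa using h2.add h3
      exact h1.eventually (eventually_le_nhds (pos_iff_ne_zero.2 (two_inv_pow_ne_zero j))))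
  set g : ℕ → ℕ → ℝ≥0∞ := fun j => h (φ₁ (φ₂ j))
  set f : ℕ → ℕ → ℝ≥0∞ := fun j k => g j (n j + k)
  have hgB : ∀ j, wsup W (g j) ≤ B := fun j => hhB _
  have hfB : ∀ j, wsup W (f j) ≤ B := fun j =>
    (wsup_le_wsup_of_injOn (fun k => n j + k) (add_right_injective (n j)).injOn
      fun k _ => le_rfl).trans (hgB j)
  have hfa : ∀ j, Antitone (f j) := fun j k l hkl => hh _ (Nat.add_le_add_left hkl _)
  have hf0 : Tendsto (fun j => f j 0) atTop (𝓝 0) :=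
    tendsto_zero_of_antitone_of_wsup_le hWs (fun j => hh _) hB hgB hnj
  -- Errors of size `2⁻¹ ^ φ₃ j` remain summable along any later subsequence, so the splitting into
  -- copies of `v` and flat tails persists.
  have hsplit : ∀ φ₃ : ℕ → ℕ, StrictMono φ₃ → ∀ (c : ℕ → ℝ≥0∞) (M : ℝ≥0∞), M ≠ ∞ →
      (∀ j, c j ≤ M) → (wsup W (fun x : ℕ × ℕ => c x.1 * g (φ₃ x.1) x.2) ≠ ∞ ↔
      wsup W (fun x : ℕ × ℕ => c x.1 * v x.2) ≠ ∞ ∧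
        wsup W (fun x : ℕ × ℕ => c x.1 * f (φ₃ x.1) x.2) ≠ ∞) := by
    intro φ₃ hφ₃ c M hM hc
    refine wsup_prod_ne_top_iff hW1 (g := fun j => g (φ₃ j)) (n := fun j => n (φ₃ j)) hM hc ?_ ?_
    · exact ne_top_of_le_ne_top tsum_two_inv_pow_ne_top (ENNReal.tsum_le_tsum fun j =>
        (hnv (φ₃ j)).trans (two_inv_pow_antitone (hφ₃.id_le j)))
    · exact ne_top_of_le_ne_top tsum_two_inv_pow_ne_top (ENNReal.tsum_le_tsum fun j =>
        (hd (φ₃ j)).trans (two_inv_pow_antitone (hφ₃.id_le j)))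
  suffices hflat : ∃ φ₃ : ℕ → ℕ, StrictMono φ₃ ∧ ∀ (c : ℕ → ℝ≥0∞) (M : ℝ≥0∞), M ≠ ∞ →
      (∀ j, c j ≤ M) → ∀ π : Equiv.Perm ℕ,
        wsup W (fun x : ℕ × ℕ => c x.1 * f (φ₃ x.1) x.2) ≠ ∞ →
          wsup W (fun x : ℕ × ℕ => c (π x.1) * f (φ₃ x.1) x.2) ≠ ∞ by
    obtain ⟨φ₃, hφ₃, hfl⟩ := hflat
    refine ⟨fun j => φ₁ (φ₂ (φ₃ j)), hφ₁.comp (hφ₂.comp hφ₃), fun c M hM hc π hfin => ?_⟩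
    obtain ⟨h1, h2⟩ := (hsplit φ₃ hφ₃ c M hM hc).1 hfin
    refine (hsplit φ₃ hφ₃ (fun j => c (π j)) M hM fun j => hc _).2 ⟨?_, hfl c M hM hc π h2⟩
    rwa [← wsup_comp_equiv (Equiv.prodCongr π (Equiv.refl ℕ))] at h1
  -- Either tails of summable size can be extracted, and every bounded `c` is admissible, or the
  -- tails are bounded below and admissibility means `∑ c j < ∞`.
  by_cases hcase : ∀ j : ℕ, ∃ᶠ i in atTop, wsup W (f i) ≤ ((2 : ℝ≥0∞)⁻¹) ^ j
  · obtain ⟨φ₃, hφ₃, hsmall⟩ := extraction_forall_of_frequently hcase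
    refine ⟨φ₃, hφ₃, fun c M hM hc π _ => ?_⟩
    exact wsup_prod_ne_top (D := fun j => f (φ₃ j)) hM (fun j => hc (π j))
      (ne_top_of_le_ne_top tsum_two_inv_pow_ne_top (ENNReal.tsum_le_tsum hsmall))
  · push Not at hcase
    obtain ⟨j₀, hj₀⟩ := hcase
    obtain ⟨φ₃, hφ₃, η, hη, hlow⟩ := exists_subseq_tsum_le_wsup hW hW0 hW1 hfa hf0
      (two_inv_pow_ne_zero j₀) (ENNReal.pow_ne_top (ENNReal.inv_ne_top.2 two_ne_zero))
      (hj₀.mono fun j hj => hj.le)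
    refine ⟨φ₃, hφ₃, fun c M hM hc π hfin => ?_⟩
    have h1 : ∑' j, c j ≠ ∞ := fun hcon => by
      have h2 := hlow c
      rw [hcon, ENNReal.top_mul hη] at h2
      exact hfin (top_le_iff.1 h2)
    refine ne_top_of_le_ne_top (ENNReal.mul_ne_top h1 hB)
      ((wsup_prod_le (fun j => c (π j)) fun j => f (φ₃ j)).trans ?_)
    rw [← Equiv.tsum_eq π c, ← ENNReal.tsum_mul_right]
    exact ENNReal.tsum_le_tsum fun j => mul_le_mul_right (hfB _) _

end Families

/-! ### Disjointly supported sequences -/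

/-- Finite support matters: the decreasing rearrangement of a sequence with infinite support and
some zeros is not a permutation of it. -/
theorem exists_perm_antitone {f : ℕ → ℝ≥0∞} {N : ℕ} (hf : ∀ i, N ≤ i → f i = 0) :
    ∃ σ : Equiv.Perm ℕ, Antitone fun k => f (σ k) := by
  set g : Fin N → ℝ≥0∞ᵒᵈ := fun i => OrderDual.toDual (f i)
  have hg : Monotone (g ∘ Tuple.sort g) := Tuple.monotone_sort g
  set σ : Equiv.Perm ℕ := (Tuple.sort g).extendDomain Fin.equivSubtype
  have h1 : ∀ k : Fin N, σ k = (Tuple.sort g k : ℕ) := fun k =>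
    Equiv.Perm.extendDomain_apply_image (Tuple.sort g) Fin.equivSubtype k
  have h2 : ∀ k, N ≤ k → σ k = k := fun k hk =>
    Equiv.Perm.extendDomain_apply_not_subtype _ _ (not_lt.2 hk)
  refine ⟨σ, fun k l hkl => ?_⟩
  by_cases hl : l < N
  · have h3 := hg (show (⟨k, lt_of_le_of_lt hkl hl⟩ : Fin N) ≤ ⟨l, hl⟩ from hkl)
    have h4 := h1 ⟨k, lt_of_le_of_lt hkl hl⟩
    have h5 := h1 ⟨l, hl⟩
    simp only at h4 h5
    simp only [h4, h5]
    exact h3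
  · simp only [h2 l (not_lt.1 hl), hf l (not_lt.1 hl)]
    exact zero_le

section Blocks

variable {𝕜 : Type*} [RCLike 𝕜] {w : ℕ → ℝ} {p : ℝ}

theorem coe_sum_apply {hw : w ∈ lorentzWeights} {hp : 0 < p} (u : ℕ → lorentzSpace 𝕜 w hw p hp)
    (a : ℕ → 𝕜) (S : Finset ℕ) (i : ℕ) :
    ((∑ j ∈ S, a j • u j : lorentzSpace 𝕜 w hw p hp) : ℕ → 𝕜) i =
      ∑ j ∈ S, a j * (u j : ℕ → 𝕜) i := by
  rw [Submodule.coe_sum, Finset.sum_apply]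
  rfl

theorem coe_sum_range_apply_of_disjoint {hw : w ∈ lorentzWeights} {hp : 0 < p}
    {u : ℕ → lorentzSpace 𝕜 w hw p hp} {i J : ℕ} (hJ : ∀ j, (u j : ℕ → 𝕜) i ≠ 0 → j = J)
    (a : ℕ → 𝕜) (n : ℕ) :
    ((∑ j ∈ Finset.range n, a j • u j : lorentzSpace 𝕜 w hw p hp) : ℕ → 𝕜) i =
      if J < n then a J * (u J : ℕ → 𝕜) i else 0 := by
  have h0 : ∀ j, j ≠ J → a j * (u j : ℕ → 𝕜) i = 0 := fun j hj => by
    by_contra hcon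
    exact hj (hJ j (right_ne_zero_of_mul hcon))
  rw [coe_sum_apply]
  split_ifs with h
  · exact Finset.sum_eq_single J (fun j _ hj => h0 j hj) fun h' =>
      absurd (Finset.mem_range.2 h) h'
  · refine Finset.sum_eq_zero fun j hj => h0 j ?_
    rintro rfl
    exact h (Finset.mem_range.1 hj)

/-- A series of disjointly supported vectors converges if and only if its formal sum has finite
Lorentz quasi-norm. -/
theorem seriesConverges_iff_of_disjoint (hw : w ∈ lorentzWeights) (hp : 0 < p)
    {u : ℕ → lorentzSpace 𝕜 w hw p hp}
    (hu : ∀ i j j', (u j : ℕ → 𝕜) i ≠ 0 → (u j' : ℕ → 𝕜) i ≠ 0 → j = j') (a : ℕ → 𝕜) :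
    SeriesConverges (lorentzQuasiNorm 𝕜 w hw p hp) u a ↔
      wsup (eweight w) (fun x : ℕ × ℕ => ‖a x.1‖ₑ ^ p * ‖(u x.1 : ℕ → 𝕜) x.2‖ₑ ^ p) ≠ ∞ := by
  have hr : 0 < min 1 p := lt_min one_pos hp
  have hsub := lorentzQuasiNorm_add_rpow_le (𝕜 := 𝕜) hw hp
  have hex : ∀ i, ∃ J, ∀ j, (u j : ℕ → 𝕜) i ≠ 0 → j = J := by
    intro i
    by_cases h : ∃ J, (u J : ℕ → 𝕜) i ≠ 0
    · obtain ⟨J, hJ⟩ := h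
      exact ⟨J, fun j hj => hu i j J hj hJ⟩
    · push Not at h
      exact ⟨0, fun j hj => absurd (h j) hj⟩
  -- `J i` is the only index whose vector can be nonzero at coordinate `i`; it is arbitrary if there
  -- is none.
  choose J hJ using hex
  have hmul : ∀ j i, ‖a j * (u j : ℕ → 𝕜) i‖ₑ ^ p = ‖a j‖ₑ ^ p * ‖(u j : ℕ → 𝕜) i‖ₑ ^ p :=
    fun j i => by rw [enorm_mul, ENNReal.mul_rpow_of_nonneg _ _ hp.le]
  have hJ' : ∀ x : ℕ × ℕ, ‖a x.1‖ₑ ^ p * ‖(u x.1 : ℕ → 𝕜) x.2‖ₑ ^ p ≠ 0 → x.1 = J x.2 := by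
    intro x hx
    refine hJ x.2 x.1 fun h => hx ?_
    rw [h, enorm_zero, ENNReal.zero_rpow_of_pos hp, mul_zero]
  constructor
  · intro h
    obtain ⟨C, hC⟩ := h.bddAbove hr hsub
    have hC0 : 0 ≤ C := (VecQuasiNorm.nonneg _ _).trans (hC 0)
    refine ne_top_of_le_ne_top (ENNReal.ofReal_ne_top (r := C ^ p)) (wsup_le_of_tendsto
      (eweight_ne_top w) (g := fun n (x : ℕ × ℕ) => if x.1 < n then
        ‖a x.1‖ₑ ^ p * ‖(u x.1 : ℕ → 𝕜) x.2‖ₑ ^ p else 0) (fun x => ?_)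
      (Eventually.of_forall fun n => ?_))
    · refine tendsto_const_nhds.congr' ?_
      filter_upwards [eventually_gt_atTop x.1] with n hn
      rw [if_pos hn]
    · refine le_trans ?_ ((lorentzQuasiNorm_le_iff hw hp _ hC0).1 (hC n))
      have hlt : ∀ x : ℕ × ℕ, (if x.1 < n then
          ‖a x.1‖ₑ ^ p * ‖(u x.1 : ℕ → 𝕜) x.2‖ₑ ^ p else 0) ≠ 0 → x.1 < n ∧ x.1 = J x.2 := by
        intro x hx
        by_cases hn : x.1 < n
        · rw [if_pos hn] at hx
          exact ⟨hn, hJ' x hx⟩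
        · exact absurd (if_neg hn) hx
      refine wsup_le_wsup_of_injOn Prod.snd ?_ fun x hx => ?_
      · rintro ⟨j, i⟩ hx ⟨j', i'⟩ hy (h : i = i')
        subst h
        exact Prod.ext ((hlt _ hx).2.trans (hlt _ hy).2.symm) rfl
      · obtain ⟨h1, h2⟩ := hlt x hx
        rw [if_pos h1, coe_sum_range_apply_of_disjoint (hJ x.2), if_pos (h2 ▸ h1), ← h2, hmul]
  · intro h
    have hcomp := lorentzQuasiNorm_isComplete (𝕜 := 𝕜) hw hp
    refine hcomp (fun n => ∑ j ∈ Finset.range n, a j • u j) fun ε hε => ?_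
    obtain ⟨A, hA⟩ := exists_finset_wsup_le (tsum_eweight hw) (eweight_le_one hw) h
      (ε := ENNReal.ofReal ((ε / 2) ^ p)) (ENNReal.ofReal_pos.2 (by positivity)).ne'
    refine ⟨A.sup Prod.fst + 1, fun m hm n hn => ?_⟩
    refine lt_of_le_of_lt ((lorentzQuasiNorm_le_iff hw hp _ (half_pos hε).le).2 ?_)
      (half_lt_self hε)
    refine le_trans ?_ (hA (fun x => if A.sup Prod.fst < x.1 then
        ‖a x.1‖ₑ ^ p * ‖(u x.1 : ℕ → 𝕜) x.2‖ₑ ^ p else 0) (fun x hx => ?_) fun x => ?_)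
    · refine wsup_le_wsup_of_injOn (fun i => (J i, i)) (fun i _ i' _ h => (Prod.ext_iff.1 h).2)
        fun i _ => ?_
      have h1 : ((∑ j ∈ Finset.range m, a j • u j - ∑ j ∈ Finset.range n, a j • u j :
          lorentzSpace 𝕜 w hw p hp) : ℕ → 𝕜) i = (if J i < m then a (J i) * (u (J i) : ℕ → 𝕜) i
            else 0) - (if J i < n then a (J i) * (u (J i) : ℕ → 𝕜) i else 0) := by
        rw [← coe_sum_range_apply_of_disjoint (hJ i), ← coe_sum_range_apply_of_disjoint (hJ i)]
        rfl
      rw [h1]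
      by_cases hi : A.sup Prod.fst < J i
      · rw [if_pos hi, ← hmul]
        refine ENNReal.rpow_le_rpow ?_ hp.le
        split_ifs <;> simp
      · rw [if_pos (by lia), if_pos (by lia), sub_self, enorm_zero, ENNReal.zero_rpow_of_pos hp]
        exact zero_le
    · exact if_neg (not_lt.2 (Finset.le_sup (f := Prod.fst) hx))
    · split_ifs
      · exact le_rfl
      · exact zero_le

theorem indicator_mem_lorentzSpace (hw : w ∈ lorentzWeights) (hp : 0 < p)
    (a : lorentzSpace 𝕜 w hw p hp) (S : Set ℕ) :
    S.indicator (a : ℕ → 𝕜) ∈ lorentzSpace 𝕜 w hw p hp := by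
  rw [mem_lorentzSpace hw hp]
  refine ne_top_of_le_ne_top ((mem_lorentzSpace hw hp).1 a.2) (wsup_mono fun i => ?_)
  refine ENNReal.rpow_le_rpow ?_ hp.le
  by_cases hi : i ∈ S <;> simp [hi]

/-- A coordinatewise null sequence has a subsequence that is a small perturbation of a sequence of
finitely and disjointly supported truncations. -/
theorem exists_subseq_disjoint_approx (hw : w ∈ lorentzWeights) (hp : 0 < p)
    {z : ℕ → lorentzSpace 𝕜 w hw p hp}
    (hz : ∀ i, Tendsto (fun j => (z j : ℕ → 𝕜) i) atTop (𝓝 0)) {η : ℕ → ℝ} (hη : ∀ j, 0 < η j)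
    (hηa : Antitone η) :
    ∃ (φ : ℕ → ℕ) (u : ℕ → lorentzSpace 𝕜 w hw p hp), StrictMono φ ∧
      (∀ j, (lorentzQuasiNorm 𝕜 w hw p hp).toFun (z (φ j) - u j) ≤ η j) ∧
      (∀ j i, ‖(u j : ℕ → 𝕜) i‖ ≤ ‖(z (φ j) : ℕ → 𝕜) i‖) ∧
      (∀ j, ∃ N, ∀ i, N ≤ i → (u j : ℕ → 𝕜) i = 0) ∧
      ∀ i j j', (u j : ℕ → 𝕜) i ≠ 0 → (u j' : ℕ → 𝕜) i ≠ 0 → j = j' := by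
  -- Gliding hump: a triple `(j, m, N)` says that `z j` is concentrated on the window `[m, N)`. The
  -- error is measured by `η m` because the position in the final sequence is not yet known; since
  -- the windows move right, the `j`-th starts at or after `j` and `η` decreases.
  obtain ⟨s, hs, hsr⟩ := exists_seq_of_forall_finset_exists
    (P := fun x : ℕ × ℕ × ℕ => x.2.1 < x.2.2 ∧ wsup (eweight w) (fun i =>
      if x.2.1 ≤ i ∧ i < x.2.2 then 0 else ‖(z x.1 : ℕ → 𝕜) i‖ₑ ^ p) ≤
        ENNReal.ofReal (η x.2.1 ^ p))
    (r := fun x y => x.1 < y.1 ∧ x.2.2 ≤ y.2.1) (by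
      intro S _
      set m := S.sup fun x => x.2.2
      have hε : ENNReal.ofReal (η m ^ p) / 2 ≠ 0 := by
        have := Real.rpow_pos_of_pos (hη m) p
        simpa using this
      have h1 : Tendsto (fun j => ∑ i ∈ Finset.range m, ‖(z j : ℕ → 𝕜) i‖ₑ ^ p) atTop (𝓝 0) := by
        rw [← Finset.sum_const_zero (s := Finset.range m) (ι := ℕ)]
        refine tendsto_finsetSum _ fun i _ => ?_
        have h2 := (ENNReal.continuous_rpow_const (y := p)).tendsto _ |>.comp (hz i).enorm
        simpa [ENNReal.zero_rpow_of_pos hp, Function.comp_def] using h2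
      obtain ⟨j, hj1, hj2⟩ := ((h1.eventually (eventually_le_nhds (pos_iff_ne_zero.2 hε))).and
        (eventually_gt_atTop (S.sup fun x => x.1))).exists
      obtain ⟨A, hA⟩ := exists_finset_wsup_le (tsum_eweight hw) (eweight_le_one hw)
        ((mem_lorentzSpace hw hp).1 (z j).2) hε
      refine ⟨(j, m, max (m + 1) (A.sup id + 1)), ⟨lt_of_lt_of_le (Nat.lt_succ_self m)
        (le_max_left _ _), ?_⟩, fun x hx => ⟨?_, ?_⟩⟩
      · rw [← ENNReal.add_halves (ENNReal.ofReal (η m ^ p))]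
        refine le_trans ?_ (add_le_add hj1 (hA (fun i => if max (m + 1) (A.sup id + 1) ≤ i then
          ‖(z j : ℕ → 𝕜) i‖ₑ ^ p else 0) (fun i hi => if_neg ?_) fun i => ?_))
        · refine le_trans ?_ (add_le_add_left (wsup_le_finset_sum (eweight_le_one hw)
            (fun i => if i < m then ‖(z j : ℕ → 𝕜) i‖ₑ ^ p else 0) (Finset.range m)
            (fun i hi => if_neg (by simpa using hi)) |>.trans (Finset.sum_le_sum fun i hi => ?_)) _)
          · refine le_trans (wsup_mono fun i => ?_) (wsup_add_le _ _)
            by_cases h2 : i < m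
            · rw [if_pos h2, if_neg (by lia)]
              exact le_self_add
            · by_cases h3 : max (m + 1) (A.sup id + 1) ≤ i
              · rw [if_pos h3, if_neg (by lia)]
                exact le_add_self
              · rw [if_pos ⟨not_lt.1 h2, not_le.1 h3⟩]
                exact zero_le
          · rw [if_pos (Finset.mem_range.1 hi)]
        · have h2 : i ≤ A.sup id := Finset.le_sup (f := id) hi
          lia
        · split_ifs
          · exact le_rfl
          · exact zero_le
      · exact lt_of_le_of_lt (Finset.le_sup (f := fun x : ℕ × ℕ × ℕ => x.1) hx) hj2
      · exact Finset.le_sup (f := fun x : ℕ × ℕ × ℕ => x.2.2) hx)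
  set I : ℕ → Set ℕ := fun j => Set.Ico (s j).2.1 (s j).2.2
  set u : ℕ → lorentzSpace 𝕜 w hw p hp := fun j =>
    ⟨(I j).indicator (z (s j).1 : ℕ → 𝕜), indicator_mem_lorentzSpace hw hp (z (s j).1) _⟩
  have hu : ∀ j i, (u j : ℕ → 𝕜) i = (I j).indicator (z (s j).1 : ℕ → 𝕜) i := fun j i => rfl
  have huI : ∀ j i, (u j : ℕ → 𝕜) i ≠ 0 → i ∈ I j := fun j i h => by
    by_contra hcon
    exact h ((hu j i).trans (Set.indicator_of_notMem hcon _))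
  have hmj : ∀ j, j ≤ (s j).2.1 := by
    have hmono : StrictMono fun j => (s j).2.1 := fun i j hij =>
      lt_of_lt_of_le (hs i).1 (hsr i j hij).2
    exact fun j => hmono.id_le j
  refine ⟨fun j => (s j).1, u, fun i j h => (hsr i j h).1, fun j => ?_, fun j i => ?_,
    fun j => ⟨(s j).2.2, fun i hi => ?_⟩, fun i j j' h h' => ?_⟩
  · refine le_trans ((lorentzQuasiNorm_le_iff hw hp _ (hη (s j).2.1).le).2
      (le_trans (wsup_mono fun i => ?_) (hs j).2)) (hηa (hmj j))
    have h1 : ((z (s j).1 - u j : lorentzSpace 𝕜 w hw p hp) : ℕ → 𝕜) i =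
      (z (s j).1 : ℕ → 𝕜) i - (I j).indicator (z (s j).1 : ℕ → 𝕜) i := rfl
    rw [h1]
    split_ifs with h2
    · rw [Set.indicator_of_mem (show i ∈ I j from h2), sub_self, enorm_zero,
        ENNReal.zero_rpow_of_pos hp]
    · rw [Set.indicator_of_notMem (show i ∉ I j from h2), sub_zero]
  · rw [hu]
    by_cases hi : i ∈ I j <;> simp [hi]
  · by_contra hcon
    exact absurd (huI j i hcon).2 (not_lt.2 hi)
  · have h1 := huI j i h
    have h2 := huI j' i h'
    rcases lt_trichotomy j j' with h3 | h3 | h3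
    · exact absurd (lt_of_lt_of_le h1.2 ((hsr j j' h3).2.trans h2.1)) (lt_irrefl _)
    · exact h3
    · exact absurd (lt_of_lt_of_le h2.2 ((hsr j' j h3).2.trans h1.1)) (lt_irrefl _)

end Blocks

/-! ### Subsymmetric basic sequences -/

theorem exists_forall_le_of_eventually_le {f : ℕ → ℝ} {t : ℝ} (h : ∀ᶠ j in atTop, f j ≤ t) :
    ∃ C, ∀ j, f j ≤ C := by
  have h1 : IsBoundedUnder (· ≤ ·) atTop f := ⟨t, h⟩
  obtain ⟨C, hC⟩ := h1.bddAbove_range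
  exact ⟨C, fun j => hC ⟨j, rfl⟩⟩

section Subsymmetric

variable {𝕜 X : Type*} [RCLike 𝕜] [AddCommGroup X] [Module 𝕜 X] {q : VecQuasiNorm 𝕜 X} {r : ℝ}

theorem IsSubsymmetricBasicSeq.seriesConverges_iff {x : ℕ → X} (hx : IsSubsymmetricBasicSeq q x)
    {φ : ℕ → ℕ} (hφ : StrictMono φ) (a : ℕ → 𝕜) :
    SeriesConverges q (fun j => x (φ j)) a ↔ SeriesConverges q x a :=
  (hx.2.2 φ hφ).2.2 a

theorem half_pow_rpow_pos (r : ℝ) (j : ℕ) : 0 < (((1 : ℝ) / 2) ^ j) ^ (1 / r) := by positivity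

theorem half_pow_rpow_rpow (hr : 0 < r) (j : ℕ) :
    ((((1 : ℝ) / 2) ^ j) ^ (1 / r)) ^ r = (1 / 2) ^ j := by
  rw [← Real.rpow_mul (by positivity), one_div_mul_cancel hr.ne', Real.rpow_one]

/-- Otherwise coefficients making `∑ t j • x j` absolutely convergent fail to give a null sequence
along a subsequence with rapidly growing terms. -/
theorem IsSubsymmetricBasicSeq.exists_le (hr : 0 < r)
    (hsub : ∀ u v, q.toFun (u + v) ^ r ≤ q.toFun u ^ r + q.toFun v ^ r) (hq : q.IsComplete)
    {x : ℕ → X} (hx : IsSubsymmetricBasicSeq q x) : ∃ C, ∀ j, q.toFun (x j) ≤ C := by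
  by_contra hcon
  have hpos : ∀ j, 0 < q.toFun (x j) := fun j => (q.nonneg _).lt_of_ne fun h =>
    hx.1.ne_zero hr hsub j ((q.eq_zero_iff _).1 h.symm)
  set η : ℕ → ℝ := fun j => (((1 : ℝ) / 2) ^ j) ^ (1 / r)
  have hη : ∀ j, 0 < η j := half_pow_rpow_pos r
  set t : ℕ → ℝ := fun j => η j / q.toFun (x j)
  have ht : ∀ j, 0 < t j := fun j => div_pos (hη j) (hpos j)
  have hfreq : ∀ j, ∃ᶠ i in atTop, (t j)⁻¹ < q.toFun (x i) := fun j h =>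
    hcon (exists_forall_le_of_eventually_le (h.mono fun i hi => not_lt.1 hi))
  obtain ⟨φ, hφ, hlarge⟩ := extraction_forall_of_frequently hfreq
  have hqt : ∀ j v, q.toFun ((t j : 𝕜) • v) = t j * q.toFun v := fun j v => by
    rw [q.smul_eq, RCLike.norm_ofReal, abs_of_pos (ht j)]
  have h1 : SeriesConverges q x fun j => (t j : 𝕜) := by
    refine seriesConverges_of_summable hr hsub hq ?_
    refine (summable_geometric_of_lt_one (r := (1 : ℝ) / 2) (by norm_num)
      (by norm_num)).congr fun j => ?_
    rw [hqt, div_mul_cancel₀ _ (hpos j).ne', half_pow_rpow_rpow hr]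
  have h2 := ((hx.seriesConverges_iff hφ _).2 h1).tendsto_zero hr hsub
  refine absurd (ge_of_tendsto' h2 (b := 1) fun j => ?_) (by norm_num)
  rw [hqt, ← inv_mul_le_iff₀ (ht j), mul_one]
  exact (hlarge j).le

/-- Otherwise the normalizing coefficients `t j` of `x` itself give a convergent series along a
subsequence with rapidly decreasing terms, while `t j • x j` has quasi-norm `1`. -/
theorem IsSubsymmetricBasicSeq.exists_pos_le (hr : 0 < r)
    (hsub : ∀ u v, q.toFun (u + v) ^ r ≤ q.toFun u ^ r + q.toFun v ^ r) (hq : q.IsComplete)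
    {x : ℕ → X} (hx : IsSubsymmetricBasicSeq q x) : ∃ c > 0, ∀ j, c ≤ q.toFun (x j) := by
  have hpos : ∀ j, 0 < q.toFun (x j) := fun j => (q.nonneg _).lt_of_ne fun h =>
    hx.1.ne_zero hr hsub j ((q.eq_zero_iff _).1 h.symm)
  suffices h : ∃ C, ∀ j, (q.toFun (x j))⁻¹ ≤ C by
    obtain ⟨C, hC⟩ := h
    have hC0 : 0 < C := (inv_pos.2 (hpos 0)).trans_le (hC 0)
    exact ⟨C⁻¹, inv_pos.2 hC0, fun j => inv_le_of_inv_le₀ (hpos j) (hC j)⟩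
  by_contra hcon
  set η : ℕ → ℝ := fun j => (((1 : ℝ) / 2) ^ j) ^ (1 / r)
  have hη : ∀ j, 0 < η j := half_pow_rpow_pos r
  set t : ℕ → ℝ := fun j => (q.toFun (x j))⁻¹
  have ht : ∀ j, 0 < t j := fun j => inv_pos.2 (hpos j)
  have hfreq : ∀ j, ∃ᶠ i in atTop, t j / η j < (q.toFun (x i))⁻¹ := fun j h =>
    hcon (exists_forall_le_of_eventually_le (h.mono fun i hi => not_lt.1 hi))
  obtain ⟨φ, hφ, hsmall⟩ := extraction_forall_of_frequently hfreq
  have hqt : ∀ j v, q.toFun ((t j : 𝕜) • v) = t j * q.toFun v := fun j v => by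
    rw [q.smul_eq, RCLike.norm_ofReal, abs_of_pos (ht j)]
  have h1 : SeriesConverges q (fun j => x (φ j)) fun j => (t j : 𝕜) := by
    refine seriesConverges_of_summable hr hsub hq ?_
    refine Summable.of_nonneg_of_le (fun j => Real.rpow_nonneg (q.nonneg _) _) (fun j => ?_)
      (summable_geometric_of_lt_one (r := (1 : ℝ) / 2) (by norm_num) (by norm_num))
    rw [← half_pow_rpow_rpow hr j]
    refine Real.rpow_le_rpow (q.nonneg _) ?_ hr.le
    have h2 := hsmall j
    rw [div_lt_iff₀ (hη j), ← div_eq_inv_mul, lt_div_iff₀ (hpos _)] at h2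
    rw [hqt]
    exact h2.le
  have h2 := ((hx.seriesConverges_iff hφ _).1 h1).tendsto_zero hr hsub
  refine absurd (ge_of_tendsto' h2 (b := 1) fun j => ?_) (by norm_num)
  rw [hqt, inv_mul_cancel₀ (hpos j).ne']

theorem seriesConverges_const {a : ℕ → 𝕜} (ha : Summable a) (y : X) :
    SeriesConverges q (fun _ => y) a := by
  refine ⟨(∑' j, a j) • y, ?_⟩
  have h1 : Tendsto (fun n => ‖(∑' j, a j) - ∑ j ∈ Finset.range n, a j‖ * q.toFun y) atTop
      (𝓝 (0 * q.toFun y)) := by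
    refine Tendsto.mul_const _ ?_
    have h2 := (tendsto_const_nhds (x := ∑' j, a j)).sub ha.hasSum.tendsto_sum_nat
    rw [sub_self] at h2
    simpa using h2.norm
  rw [zero_mul] at h1
  refine h1.congr fun n => ?_
  rw [← Finset.sum_smul, ← sub_smul, q.smul_eq]

/-- Unconditionality moves vectors and coefficients simultaneously, so permuting the vectors alone
amounts to permuting the coefficients alone, by the inverse permutation. -/
theorem IsSubsymmetricBasicSeq.isSymmetricBasicSeq_of_subseq (hr : 0 < r)
    (hsub : ∀ u v, q.toFun (u + v) ^ r ≤ q.toFun u ^ r + q.toFun v ^ r) (hq : q.IsComplete)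
    {x : ℕ → X} (hx : IsSubsymmetricBasicSeq q x) {φ : ℕ → ℕ} (hφ : StrictMono φ)
    (h : ∀ (a : ℕ → 𝕜) (π : Equiv.Perm ℕ), SeriesConverges q (fun j => x (φ j)) a →
      SeriesConverges q (fun j => x (φ j)) fun j => a (π j)) : IsSymmetricBasicSeq q x := by
  have hsymm : ∀ (a : ℕ → 𝕜) (π : Equiv.Perm ℕ), SeriesConverges q x a →
      SeriesConverges q x fun j => a (π j) := fun a π ha =>
    (hx.seriesConverges_iff hφ _).1 (h a π ((hx.seriesConverges_iff hφ a).2 ha))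
  refine ⟨hx.1, fun π => ⟨hx.2.1 π, hx.1, fun a => ⟨fun ha => ?_, fun ha => ?_⟩⟩⟩
  · have hπ : IsUnconditionalBasicSeq q fun j => x (π j) := fun ρ => hx.2.1 (ρ.trans π)
    have h1 := hπ.seriesConverges_comp_perm hr hsub hq ha π.symm
    simp only [Equiv.apply_symm_apply] at h1
    simpa only [Equiv.symm_apply_apply] using hsymm _ π h1
  · have h1 := hx.2.1.seriesConverges_comp_perm hr hsub hq (hsymm a π.symm ha) π
    simpa only [Equiv.symm_apply_apply] using h1

end Subsymmetric

/-! ### Extraction of symmetric subsequences in the Lorentz space. -/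

section LorentzSymmetric

variable {𝕜 : Type*} [RCLike 𝕜] {w : ℕ → ℝ} {p : ℝ}

/-- Coordinates stay in compact balls, and lower semicontinuity of `wsup` keeps the limit in the
space. -/
theorem exists_subseq_tendsto_coe (hw : w ∈ lorentzWeights) (hp : 0 < p)
    {x : ℕ → lorentzSpace 𝕜 w hw p hp} {C : ℝ}
    (hC : ∀ j, (lorentzQuasiNorm 𝕜 w hw p hp).toFun (x j) ≤ C) :
    ∃ (φ : ℕ → ℕ) (y : lorentzSpace 𝕜 w hw p hp), StrictMono φ ∧
      ∀ i, Tendsto (fun j => (x (φ j) : ℕ → 𝕜) i) atTop (𝓝 ((y : ℕ → 𝕜) i)) := by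
  have hC0 : 0 ≤ C := (VecQuasiNorm.nonneg _ _).trans (hC 0)
  have hcomp : IsCompact (Set.pi Set.univ fun _ : ℕ => Metric.closedBall (0 : 𝕜) C) :=
    isCompact_univ_pi fun _ => isCompact_closedBall _ _
  obtain ⟨y, -, φ, hφ, hlim⟩ := hcomp.tendsto_subseq (x := fun j => (x j : ℕ → 𝕜)) fun j i _ => by
    rw [mem_closedBall_zero_iff]
    exact (norm_apply_le_lorentzQuasiNorm hw hp (x j) i).trans (hC j)
  rw [tendsto_pi_nhds] at hlim
  refine ⟨φ, ⟨y, (mem_lorentzSpace hw hp).2 (ne_top_of_le_ne_top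
    (ENNReal.ofReal_ne_top (r := C ^ p)) (wsup_le_of_tendsto (eweight_ne_top w)
      (g := fun n i => ‖(x (φ n) : ℕ → 𝕜) i‖ₑ ^ p) (fun i => ?_)
      (Eventually.of_forall fun n => (lorentzQuasiNorm_le_iff hw hp _ hC0).1 (hC _))))⟩, hφ, hlim⟩
  exact (ENNReal.continuous_rpow_const.tendsto _).comp (hlim i).enorm

/-- A sequence of disjointly and finitely supported vectors, bounded in quasi-norm, has a
subsequence for which convergence of bounded-coefficient series is invariant under permutations
of the coefficients. -/
theorem exists_subseq_symmetric_of_disjoint (hw : w ∈ lorentzWeights) (hp : 0 < p)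
    {u : ℕ → lorentzSpace 𝕜 w hw p hp}
    (hu : ∀ i j j', (u j : ℕ → 𝕜) i ≠ 0 → (u j' : ℕ → 𝕜) i ≠ 0 → j = j')
    (hfin : ∀ j, ∃ N, ∀ i, N ≤ i → (u j : ℕ → 𝕜) i = 0) {B : ℝ≥0∞} (hB : B ≠ ∞)
    (huB : ∀ j, wsup (eweight w) (fun i => ‖(u j : ℕ → 𝕜) i‖ₑ ^ p) ≤ B) :
    ∃ φ : ℕ → ℕ, StrictMono φ ∧ ∀ (a : ℕ → 𝕜) (M : ℝ), (∀ j, ‖a j‖ ≤ M) → ∀ π : Equiv.Perm ℕ,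
      SeriesConverges (lorentzQuasiNorm 𝕜 w hw p hp) (fun j => u (φ j)) a →
        SeriesConverges (lorentzQuasiNorm 𝕜 w hw p hp) (fun j => u (φ j)) fun j => a (π j) := by
  have hsort : ∀ j, ∃ σ : Equiv.Perm ℕ, Antitone fun k => ‖(u j : ℕ → 𝕜) (σ k)‖ₑ ^ p := fun j => by
    obtain ⟨N, hN⟩ := hfin j
    exact exists_perm_antitone (f := fun i => ‖(u j : ℕ → 𝕜) i‖ₑ ^ p) (N := N) fun i hi => by
      rw [hN i hi, enorm_zero, ENNReal.zero_rpow_of_pos hp]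
  choose σ hσ using hsort
  obtain ⟨φ, hφ, hsymm⟩ := exists_subseq_wsup_symmetric (eweight_antitone hw) (tendsto_eweight hw)
    (eweight_le_one hw) (eweight_zero hw) (tsum_eweight hw) hσ hB fun j =>
      (wsup_comp_equiv (σ j) fun i => ‖(u j : ℕ → 𝕜) i‖ₑ ^ p).trans_le (huB j)
  refine ⟨φ, hφ, fun a M hM π => ?_⟩
  have hdisj : ∀ i j j', (u (φ j) : ℕ → 𝕜) i ≠ 0 → (u (φ j') : ℕ → 𝕜) i ≠ 0 → j = j' :=
    fun i j j' h h' => hφ.injective (hu i _ _ h h')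
  have hiff : ∀ b : ℕ → 𝕜,
      SeriesConverges (lorentzQuasiNorm 𝕜 w hw p hp) (fun j => u (φ j)) b ↔
        wsup (eweight w) (fun x : ℕ × ℕ =>
          ‖b x.1‖ₑ ^ p * ‖(u (φ x.1) : ℕ → 𝕜) (σ (φ x.1) x.2)‖ₑ ^ p) ≠ ∞ := fun b => by
    rw [seriesConverges_iff_of_disjoint hw hp hdisj, ← wsup_comp_equiv
      (Equiv.prodShear (Equiv.refl ℕ) fun j => σ (φ j))]
    rfl
  rw [hiff, hiff]
  refine hsymm (fun j => ‖a j‖ₑ ^ p) (ENNReal.ofReal M ^ p)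
    (ENNReal.rpow_ne_top_of_nonneg hp.le ENNReal.ofReal_ne_top)
    (fun j => ENNReal.rpow_le_rpow ?_ hp.le) π
  rw [← ofReal_norm]
  exact ENNReal.ofReal_le_ofReal (hM j)

end LorentzSymmetric

theorem mainTheorem9 {𝕜 : Type*} [RCLike 𝕜] (p : ℝ) (hp : 0 < p)
    (w : ℕ → ℝ) (hw : w ∈ lorentzWeights)
    (x : ℕ → lorentzSpace 𝕜 w hw p hp)
    (hx : IsSubsymmetricBasicSeq (lorentzQuasiNorm 𝕜 w hw p hp) x) :
    IsSymmetricBasicSeq (lorentzQuasiNorm 𝕜 w hw p hp) x := by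
  have hr : 0 < min 1 p := lt_min one_pos hp
  have hsub := lorentzQuasiNorm_add_rpow_le (𝕜 := 𝕜) hw hp
  have hcomp := lorentzQuasiNorm_isComplete (𝕜 := 𝕜) hw hp
  set q := lorentzQuasiNorm 𝕜 w hw p hp
  obtain ⟨C, hC⟩ := hx.exists_le hr hsub hcomp
  obtain ⟨c, hc0, hc⟩ := hx.exists_pos_le hr hsub hcomp
  obtain ⟨φ₁, y, hφ₁, hy⟩ := exists_subseq_tendsto_coe hw hp hC
  set η : ℕ → ℝ := fun j => (((1 : ℝ) / 2) ^ j) ^ (1 / min 1 p)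
  have hη : ∀ j, 0 < η j := half_pow_rpow_pos _
  have hηa : Antitone η := fun i j hij => Real.rpow_le_rpow (by positivity)
    (pow_le_pow_of_le_one (by norm_num) (by norm_num) hij) (by positivity)
  obtain ⟨φ₂, u, hφ₂, hue, huz, hufin, hudisj⟩ := exists_subseq_disjoint_approx hw hp
    (z := fun j => x (φ₁ j) - y) (fun i => by
      have h := (hy i).sub_const ((y : ℕ → 𝕜) i)
      rwa [sub_self] at h) hη hηa
  obtain ⟨K, hK⟩ := q.add_le
  have huB : ∃ B : ℝ≥0∞, B ≠ ∞ ∧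
      ∀ j, wsup (eweight w) (fun i => ‖(u j : ℕ → 𝕜) i‖ₑ ^ p) ≤ B := by
    obtain ⟨D, hD0, hD⟩ : ∃ D : ℝ, 0 ≤ D ∧ ∀ j, q.toFun (x (φ₁ (φ₂ j)) - y) ≤ D := by
      have hC0 : 0 ≤ C := (q.nonneg _).trans (hC 0)
      refine ⟨|K| * (C + q.toFun (-y)), mul_nonneg (abs_nonneg K) (add_nonneg hC0 (q.nonneg _)),
        fun j => ?_⟩
      rw [sub_eq_add_neg]
      exact (hK _ _).trans (mul_le_mul (le_abs_self K) (by gcongr; exact hC _)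
        (add_nonneg (q.nonneg _) (q.nonneg _)) (abs_nonneg K))
    refine ⟨ENNReal.ofReal (D ^ p), ENNReal.ofReal_ne_top, fun j => ?_⟩
    refine (wsup_mono fun i => ENNReal.rpow_le_rpow ?_ hp.le).trans
      ((lorentzQuasiNorm_le_iff hw hp _ hD0).1 (hD j))
    rw [← ofReal_norm, ← ofReal_norm]
    exact ENNReal.ofReal_le_ofReal (huz j i)
  obtain ⟨B, hB, huB⟩ := huB
  obtain ⟨φ₃, hφ₃, hsymm⟩ := exists_subseq_symmetric_of_disjoint hw hp hudisj hufin hB huB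
  set φ : ℕ → ℕ := fun j => φ₁ (φ₂ (φ₃ j))
  have hφ : StrictMono φ := hφ₁.comp (hφ₂.comp hφ₃)
  -- The subsequence is now `y + u (φ₃ j) + e j`. The error `e` has geometrically decaying `min 1
  -- p`-th powers, so its series converges for all bounded coefficients.
  set e : ℕ → lorentzSpace 𝕜 w hw p hp := fun j => x (φ j) - y - u (φ₃ j)
  have he : ∀ (a : ℕ → 𝕜) (M : ℝ), (∀ j, ‖a j‖ ≤ M) → SeriesConverges q e a := by
    intro a M hM
    refine seriesConverges_of_summable hr hsub hcomp (Summable.of_nonneg_of_le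
      (fun j => Real.rpow_nonneg (q.nonneg _) _) (fun j => ?_)
      ((summable_geometric_of_lt_one (r := (1 : ℝ) / 2) (by norm_num)
        (by norm_num)).mul_left (M ^ min 1 p)))
    rw [q.rpow_smul, ← half_pow_rpow_rpow hr j]
    refine mul_le_mul (Real.rpow_le_rpow (norm_nonneg _) (hM j) hr.le)
      (Real.rpow_le_rpow (q.nonneg _) ((hue (φ₃ j)).trans (hηa (hφ₃.id_le j))) hr.le)
      (Real.rpow_nonneg (q.nonneg _) _) (Real.rpow_nonneg ((norm_nonneg _).trans (hM j)) _)
  have hxy : ∀ i, Tendsto (fun j => (x (φ j) : ℕ → 𝕜) i) atTop (𝓝 ((y : ℕ → 𝕜) i)) := fun i =>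
    (hy i).comp (hφ₂.comp hφ₃).tendsto_atTop
  have hbdd : ∀ a : ℕ → 𝕜, SeriesConverges q (fun j => x (φ j)) a → ∃ M, ∀ j, ‖a j‖ ≤ M := by
    intro a ha
    refine exists_forall_le_of_eventually_le (t := 1) ?_
    filter_upwards [(ha.tendsto_zero hr hsub).eventually (eventually_le_nhds hc0)] with j hj
    rw [q.smul_eq] at hj
    by_contra hcon
    have h1 := mul_lt_mul_of_pos_right (not_le.1 hcon) hc0
    have h2 := mul_le_mul_of_nonneg_left (hc (φ j)) (norm_nonneg (a j))
    linarith
  have hl1 : ∀ a : ℕ → 𝕜, SeriesConverges q (fun j => x (φ j)) a → y ≠ 0 → Summable a := by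
    intro a ha hy0
    obtain ⟨i, hi⟩ : ∃ i, (y : ℕ → 𝕜) i ≠ 0 := by
      by_contra hcon
      push Not at hcon
      exact hy0 (Subtype.ext (funext hcon))
    let f : lorentzSpace 𝕜 w hw p hp →ₗ[𝕜] 𝕜 :=
      (LinearMap.proj i).comp (lorentzSpace 𝕜 w hw p hp).subtype
    -- Unconditionality is available for `x` itself, so the coefficients are first extended by zero
    -- off the range of `φ`.
    have h1 := hx.2.1.summable_norm_apply hr hsub hcomp (ha.extend hφ) f
      fun v => norm_apply_le_lorentzQuasiNorm hw hp v i
    have h2 := h1.comp_injective hφ.injective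
    refine Summable.of_norm_bounded_eventually_nat
      (h2.mul_left (2 / ‖(y : ℕ → 𝕜) i‖)) ?_
    have hyi : 0 < ‖(y : ℕ → 𝕜) i‖ := norm_pos_iff.2 hi
    filter_upwards [(hxy i).norm.eventually (le_mem_nhds (half_lt_self hyi))] with j hj
    have h3 : Function.extend φ a 0 (φ j) = a j := hφ.injective.extend_apply a 0 j
    simp only [Function.comp_apply, h3, norm_mul]
    have h4 : f (x (φ j)) = (x (φ j) : ℕ → 𝕜) i := rfl
    rw [h4]
    calc ‖a j‖ = 2 / ‖(y : ℕ → 𝕜) i‖ * (‖a j‖ * (‖(y : ℕ → 𝕜) i‖ / 2)) := by field_simp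
      _ ≤ _ := by gcongr
  have hyc : ∀ a : ℕ → 𝕜, (y ≠ 0 → Summable a) → SeriesConverges q (fun _ => y) a := by
    intro a ha
    by_cases hy0 : y = 0
    · refine ⟨0, ?_⟩
      rw [hy0]
      simp only [SeriesHasLimit, smul_zero, Finset.sum_const_zero, sub_zero,
        (q.eq_zero_iff 0).2 rfl]
      exact tendsto_const_nhds
    · exact seriesConverges_const (ha hy0) y
  refine hx.isSymmetricBasicSeq_of_subseq hr hsub hcomp hφ fun a π ha => ?_
  obtain ⟨M, hM⟩ := hbdd a ha
  have hye := (hyc a (hl1 a ha)).add_seq hr hsub (he a M hM) fun _ => rfl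
  -- Subtracting the convergent series of `y + e` isolates the disjoint part; its coefficients are
  -- permuted, and the other two parts are added back.
  have hua : SeriesConverges q (fun j => u (φ₃ j)) a :=
    ha.add_seq hr hsub (hye.neg_seq hr hsub) fun j => by
      simp only [e]
      abel
  have hua' := hsymm a M hM π hua
  have hye' := (hyc (fun j => a (π j)) fun hy0 => (hl1 a ha hy0).comp_injective π.injective).add_seq
    hr hsub (he (fun j => a (π j)) M fun j => hM _) fun _ => rfl
  exact hye'.add_seq hr hsub hua' fun j => by
    simp only [e]
    abel
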